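/- Let $X$ be a (Hausdorff, second countable) topological manifold of dimension $D\ge 1$, possibly with boundary, and let $U_1,\dots,U_n\subseteq X$ be closed, properly embedded, locally flat $(D-1)$-dimensional topological submanifolds, possibly with boundary and not necessarily smooth; that is, locally the pair $(X,U_i)$ looks like $(H\times\mathbb{R},\,H\times\{0\})$ with $H$ a half-space of $\mathbb{R}^{D-1}$ (so $\partial U_i\subseteq\partial X$). Let each $U_i$ be transversely oriented: it has a consistent choice of a positive and a negative side. A curve $\gamma:[0,1]\to X$ is in general position if its endpoints are not on $\bigcup_i U_i$ and, wherever it meets some $U_i$, it crosses $U_i$ from one side to the other. The word of such a curve is obtained by tracing it and writing the letter $u_i$ (respectively $u_i^{-1}$) at each crossing of $U_i$ from the negative to the positive side (respectively from the positive to the negative side). Let $h(\gamma)$ be the element of the free group $\langle u_1,\dots,u_n\rangle$ that this word represents. Suppose that 1. $U_i\cap U_j=\emptyset$ for all $i\ne j$; 2. $X\setminus\bigcup_{i=1}^n U_i$ is path connected and simply connected; 3. $\pi_1\bigl(X\setminus\bigcup_{i\ne j}U_i\bigr)\cong\mathbb{Z}$ for every $j=1,\dots,n$. Then the following hold. (a)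 Every curve in general position has a (unique, finite) word, and every curve in $X$ with endpoints off $\bigcup_i U_i$ is homotopic, with fixed endpoints, to a curve in general position. (b) The words are complete homotopy invariants: two curves $\gamma_1,\gamma_2$ in general position with the same start point and the same end point are homotopic with fixed endpoints if and only if $h(\gamma_1)=h(\gamma_2)$. (c) $X$ is path connected, and $\pi_1(X)$ is free on the letters $u_1,\dots,u_n$: it is isomorphic to the free group $\langle u_1,\dots,u_n\rangle$ at every base point, and for every base point off $\bigcup_i U_i$ there is a group isomorphism $\pi_1(X)\to\langle u_1,\dots,u_n\rangle$ that sends the class of each loop $\gamma$ in general position to $h(\gamma)$, where the product of two classes of loops is given by traversing the first loop and then the second. -/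

import Mathlib

open Set Filter Topology unitInterval

/-- The model space for `d`-dimensional topological manifolds, possibly with boundary, for every
`d ≥ 0`: the closed half-space of `ℝ^d` in which the `0`-th coordinate is nonnegative.
For `d = 0` there is no coordinate, and this is the one-point space `ℝ^0`. -/
abbrev HalfSpaceModel (d : ℕ) : Type :=
  {x : EuclideanSpace ℝ (Fin d) // ∀ k : Fin d, (k : ℕ) = 0 → 0 ≤ x k}

/-- A properly embedded, locally flat `d`-dimensional topological submanifold `U` (possibly with
boundary, in no way smooth) of a `(d+1)`-dimensional topological manifold `X` (possibly with
boundary), together with a transverse orientation.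

The pair `(X, U)` is locally modelled on `(H × ℝ, H × {0})` with `H` the `d`-dimensional
half-space, through the charts in `charts`. So `U` is a `d`-manifold, points of `U` over the
interior of `H` are interior in both `U` and `X`, and points of `U` over the boundary of `H` are
boundary points of both: `∂U ⊆ ∂X`. The positive side of `U` near one of its points is the
one on which the last coordinate of a chart is positive, and all charts of the family agree on
which side that is. -/
structure OrientedHypersurface (X : Type*) [TopologicalSpace X] (d : ℕ) where
  /-- the underlying subset `U` of `X` -/
  carrier : Set X
  isClosed_carrier : IsClosed carrier
  /-- a family of flat charts, which gives the transverse orientation -/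
  charts : Set (OpenPartialHomeomorph X (HalfSpaceModel d × ℝ))
  exists_chart : ∀ p ∈ carrier, ∃ e ∈ charts, p ∈ e.source
  mem_carrier_iff : ∀ e ∈ charts, ∀ x ∈ e.source, (x ∈ carrier ↔ (e x).2 = 0)
  side_compatible : ∀ e ∈ charts, ∀ e' ∈ charts, ∀ p ∈ carrier, p ∈ e.source → p ∈ e'.source →
    ∀ᶠ x in 𝓝 p, (0 < (e x).2 ↔ 0 < (e' x).2)

namespace OrientedHypersurface

variable {X : Type*} [TopologicalSpace X] {d : ℕ}

/-- The curve `γ` crosses `U` at time `t` with positive orientation: `γ t` lies on `U`, and `γ` is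
on the negative side of `U` just before `t` and on its positive side just after `t`. -/
def CrossesPos (U : OrientedHypersurface X d) {x y : X} (γ : Path x y) (t : I) : Prop :=
  ∃ e ∈ U.charts, γ t ∈ e.source ∧ γ t ∈ U.carrier ∧
    (∀ᶠ s in 𝓝[<] t, (e (γ s)).2 < 0) ∧ (∀ᶠ s in 𝓝[>] t, 0 < (e (γ s)).2)

/-- The curve `γ` crosses `U` at time `t` with negative orientation: `γ t` lies on `U`, and `γ` is
on the positive side of `U` just before `t` and on its negative side just after `t`. -/
def CrossesNeg (U : OrientedHypersurface X d) {x y : X} (γ : Path x y) (t : I) : Prop :=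
  ∃ e ∈ U.charts, γ t ∈ e.source ∧ γ t ∈ U.carrier ∧
    (∀ᶠ s in 𝓝[<] t, 0 < (e (γ s)).2) ∧ (∀ᶠ s in 𝓝[>] t, (e (γ s)).2 < 0)

end OrientedHypersurface

section Words

variable {X : Type*} [TopologicalSpace X] {d n : ℕ}

/-- The union of all the hypersurfaces. -/
def unionAll (U : Fin n → OrientedHypersurface X d) : Set X :=
  ⋃ i, (U i).carrier

/-- The union of all the hypersurfaces but the `j`-th. -/
def unionExcept (U : Fin n → OrientedHypersurface X d) (j : Fin n) : Set X :=
  ⋃ i, ⋃ (_ : i ≠ j), (U i).carrier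

/-- The curve `γ` is in general position (transverse) with respect to the hypersurfaces: its
endpoints are not on them, and wherever it meets one of them, it crosses it from one side to the
other. -/
def InGeneralPosition (U : Fin n → OrientedHypersurface X d) {x y : X} (γ : Path x y) : Prop :=
  x ∉ unionAll U ∧ y ∉ unionAll U ∧
    ∀ (i : Fin n) (t : I), γ t ∈ (U i).carrier → (U i).CrossesPos γ t ∨ (U i).CrossesNeg γ t

/-- The letter `(i, true)`, which stands for `u_i`, or `(i, false)`, which stands for `u_i⁻¹`, is
the one to be inserted at time `t` when the curve `γ` is traced. -/
def IsLetterAt (U : Fin n → OrientedHypersurface X d) {x y : X} (γ : Path x y)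
    (t : I) (l : Fin n × Bool) : Prop :=
  (l.2 = true ∧ (U l.1).CrossesPos γ t) ∨ (l.2 = false ∧ (U l.1).CrossesNeg γ t)

/-- `w` is the (unreduced) word of the curve `γ`: `γ` is in general position, and `w` lists, in the
order of time, the letters of all the crossings of `γ` with the hypersurfaces.

The word as an element of the free group on the letters, that is, up to the cancellation of
adjacent mutually inverse letters, is `FreeGroup.mk w`. -/
def IsCrossingWord (U : Fin n → OrientedHypersurface X d) {x y : X} (γ : Path x y)
    (w : List (Fin n × Bool)) : Prop :=
  InGeneralPosition U γ ∧
    ∃ ts : List I, ts.Pairwise (· < ·) ∧ (∀ t : I, t ∈ ts ↔ γ t ∈ unionAll U) ∧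
      List.Forall₂ (IsLetterAt U γ) ts w

end Words

/-!
Let `W` be the complement of all the hypersurfaces `U i`. The flat charts give each `U i` a side
function, which is `u_i` on the positive side and `1` on the negative one. Together with the
constant `1` on `W`, these functions with values in the free group agree on overlaps up to locally
constant factors (`crossingPotential`), so they define a covering space of `X` with the free group as fibre,
and its monodromy is a homotopy invariant of paths (`LocalPotential.holonomy`) that is
multiplicative under concatenation, trivial in `W`, and equal to `u_i` or `u_i⁻¹` across a single
crossing. Hence the holonomy of a curve in general position is its word, which is therefore a
homotopy invariant.

Completeness is where the hypotheses on fundamental groups enter. As `W` is path connected, there is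
at each base point a loop that crosses only `U i`, with holonomy `u_i` (`exists_dual_loop`). The
exponent sum of `u_i` is thus a surjection from the fundamental group of the complement of the other
hypersurfaces, which is infinite cyclic, onto `ℤ`, and a surjection of `ℤ` onto itself is injective:
loops that avoid the other hypersurfaces are determined by their holonomy
(`homotopic_of_crossingHolonomy_eq`). Cutting a curve in general position between consecutive
crossings and returning to the base point through the simply connected `W` shows that it is
homotopic to the product of dual loops that its word spells
(`IsCrossingWord.mk_trans_eq_loopClass`), so that its word determines its class.

Finally, every class of paths has a member in general position
(`exists_homotopic_inGeneralPosition`): a path is cut into pieces that lie in `W` or in a flat box,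
the ends of the pieces are pushed off the hypersurfaces, and each piece in a box is replaced by a
chord, along which the transverse coordinate is affine. Holonomy is then an isomorphism from the
fundamental group to the free group, with the dual loops giving its inverse.
-/

local notation "⟦" γ "⟧ₕ" => Path.Homotopic.Quotient.mk γ

/-! ### Homotopy classes of paths -/

section PathClasses

variable {X : Type*} [TopologicalSpace X]

theorem Path.mk_subpath_trans {x y : X} (γ : Path x y) (r s t : I) :
    (⟦γ.subpath r s⟧ₕ).trans ⟦γ.subpath s t⟧ₕ = ⟦γ.subpath r t⟧ₕ :=
  Path.Homotopic.Quotient.eq.2 ⟨Path.Homotopy.subpathTransSubpath γ r s t⟩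

theorem Path.subpath_mem_of_forall_Icc {x y : X} (γ : Path x y) {s t : I} (hst : s ≤ t) {S : Set X}
    (h : ∀ u, s ≤ u → u ≤ t → γ u ∈ S) (r : I) : γ.subpath s t r ∈ S := by
  have : γ.subpath s t r ∈ range (γ.subpath s t) := mem_range_self r
  rw [Path.range_subpath_of_le _ _ _ hst] at this
  obtain ⟨u, hu, hu'⟩ := this
  exact hu' ▸ h u hu.1 hu.2

/-- A path splits, up to homotopy, at any of its points. -/
theorem Path.exists_mk_eq_trans {x y : X} (γ : Path x y) (t : I) :
    ∃ (α : Path x (γ t)) (β : Path (γ t) y), ⟦γ⟧ₕ = (⟦α⟧ₕ).trans ⟦β⟧ₕ ∧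
      (∀ s, ∃ u ≤ t, α s = γ u) ∧ (∀ s, ∃ u ≥ t, β s = γ u) := by
  refine ⟨(γ.subpath 0 t).cast γ.source.symm rfl, (γ.subpath t 1).cast rfl γ.target.symm, ?_, ?_,
    ?_⟩
  · have h := γ.mk_subpath_trans 0 t 1
    rw [Path.subpath_zero_one] at h
    have key : ∀ (x' y' : X) (hx : x = x') (hy : y = y') (a : Path x' (γ t)) (b : Path (γ t) y'),
        (⟦a⟧ₕ).trans ⟦b⟧ₕ = ⟦γ.cast hx.symm hy.symm⟧ₕ →
          ⟦γ⟧ₕ = (⟦a.cast hx rfl⟧ₕ).trans ⟦b.cast rfl hy⟧ₕ := by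
      rintro _ _ rfl rfl a b h
      exact h.symm
    exact key _ _ γ.source.symm γ.target.symm _ _ h
  · intro s
    have := γ.subpath_mem_of_forall_Icc (zero_le : (0 : I) ≤ t) (S := γ '' Iic t)
      (fun u _ hu => ⟨u, hu, rfl⟩) s
    obtain ⟨u, hu, hu'⟩ := this
    exact ⟨u, hu, hu'.symm⟩
  · intro s
    have := γ.subpath_mem_of_forall_Icc (le_one' : t ≤ 1) (S := γ '' Ici t)
      (fun u hu _ => ⟨u, hu, rfl⟩) s
    obtain ⟨u, hu, hu'⟩ := this
    exact ⟨u, hu, hu'.symm⟩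

/-- A property of homotopy classes of paths that is stable under concatenation and holds for all
sufficiently small paths holds for all paths. -/
theorem Path.Homotopic.Quotient.induction_of_local
    {P : ∀ {x y : X}, Path.Homotopic.Quotient x y → Prop}
    (trans : ∀ {x y z : X} (a : Path.Homotopic.Quotient x y) (b : Path.Homotopic.Quotient y z),
      P a → P b → P (a.trans b))
    (small : ∀ p : X, ∃ N ∈ 𝓝 p, ∀ {x y : X} (γ : Path x y), (∀ t, γ t ∈ N) → P ⟦γ⟧ₕ)
    {x y : X} (a : Path.Homotopic.Quotient x y) : P a := by
  induction a with | mk γ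
  choose N hN hP using small
  obtain ⟨t, t_zero, t_mono, ⟨m, hm⟩, ht⟩ := exists_monotone_Icc_subset_open_cover_unitInterval
    (c := fun p : X => γ ⁻¹' interior (N p))
    (fun p => isOpen_interior.preimage γ.continuous)
    (fun s _ => mem_iUnion.2 ⟨γ s, mem_interior_iff_mem_nhds.2 (hN (γ s))⟩)
  have key : ∀ k, P ⟦γ.subpath (t 0) (t k)⟧ₕ := by
    intro k
    induction k with
    | zero =>
      refine hP (γ (t 0)) _ fun s => ?_
      rw [Path.subpath_self]
      exact mem_of_mem_nhds (hN _)
    | succ k ih =>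
      rw [← γ.mk_subpath_trans (t 0) (t k)]
      obtain ⟨p, hp⟩ := ht k
      refine trans _ _ ih (hP p _ fun s => ?_)
      exact γ.subpath_mem_of_forall_Icc (t_mono k.le_succ)
        (fun u hu hu' => interior_subset (hp ⟨hu, hu'⟩)) s
  have h := key m
  rw [t_zero, hm m le_rfl, Path.subpath_zero_one] at h
  have cast : ∀ (x' y' : X) (hx : x' = x) (hy : y' = y), P ⟦γ.cast hx hy⟧ₕ → P ⟦γ⟧ₕ := by
    rintro _ _ rfl rfl h
    exact h
  exact cast _ _ _ _ h

/-- The corestriction of a path to a set that contains it. -/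
def Path.codRestrict {x y : X} (γ : Path x y) (S : Set X) (h : ∀ t, γ t ∈ S) :
    Path (⟨x, by simpa using h 0⟩ : S) ⟨y, by simpa using h 1⟩ where
  toFun t := ⟨γ t, h t⟩
  source' := by simp
  target' := by simp

theorem Path.Homotopic.of_codRestrict {x y : X} {γ γ' : Path x y} {S : Set X}
    (h : ∀ t, γ t ∈ S) (h' : ∀ t, γ' t ∈ S)
    (H : (γ.codRestrict S h).Homotopic (γ'.codRestrict S h')) : γ.Homotopic γ' :=
  H.map ⟨Subtype.val, continuous_subtype_val⟩

theorem Path.homotopic_of_simplyConnectedSpace {S : Set X} [SimplyConnectedSpace S] {x y : X}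
    {γ γ' : Path x y} (h : ∀ t, γ t ∈ S) (h' : ∀ t, γ' t ∈ S) : γ.Homotopic γ' :=
  .of_codRestrict h h' (SimplyConnectedSpace.paths_homotopic _ _)

theorem Path.exists_of_pathConnectedSpace {S : Set X} [PathConnectedSpace S] {x y : X}
    (hx : x ∈ S) (hy : y ∈ S) : ∃ γ : Path x y, ∀ t, γ t ∈ S :=
  ⟨(PathConnectedSpace.somePath (⟨x, hx⟩ : S) ⟨y, hy⟩).map continuous_subtype_val,
    fun _ => Subtype.coe_prop _⟩

theorem Path.trans_mem {x y z : X} {S : Set X} {γ : Path x y} {γ' : Path y z}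
    (h : ∀ t, γ t ∈ S) (h' : ∀ t, γ' t ∈ S) (t : I) : γ.trans γ' t ∈ S := by
  rw [Path.trans_apply]
  split_ifs
  exacts [h _, h' _]

theorem Path.symm_mem {x y : X} {S : Set X} {γ : Path x y} (h : ∀ t, γ t ∈ S) (t : I) :
    γ.symm t ∈ S :=
  h _

end PathClasses

/-! ### Holonomy of local potentials -/

/-- A family of functions with values in a group `G`, defined on open sets that cover `X`, such that
the ratio of any two of them is locally constant on the intersection of their domains. These are
the primitives of a flat `G`-connection on `X`: parallel transport from `x` to `y` along a path in
the domain of `f` is multiplication by `(f x)⁻¹ * f y`. The functions are total, with arbitrary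
values outside their domains. -/
structure LocalPotential (X G ι : Type*) [TopologicalSpace X] [Group G] where
  /-- the domains of the functions -/
  dom : ι → Set X
  isOpen_dom : ∀ i, IsOpen (dom i)
  /-- a function of the family that is defined at a given point -/
  index : X → ι
  mem_dom_index : ∀ x, x ∈ dom (index x)
  /-- the functions -/
  val : ι → X → G
  eventually_ratio_eq : ∀ i j x, x ∈ dom i → x ∈ dom j →
    ∀ᶠ y in 𝓝 x, val i y * (val j y)⁻¹ = val i x * (val j x)⁻¹

namespace LocalPotential

variable {X G ι : Type*} [TopologicalSpace X] [Group G]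

/-- The principal `G`-bundle with discrete fibres that a local potential defines. Over the domain of
a function `f` of the family, the fibre coordinate is `g * (f x)⁻¹`, where `g` is a global fibre
coordinate that is not continuous. -/
def core [TopologicalSpace G] [DiscreteTopology G] (P : LocalPotential X G ι) :
    FiberBundleCore ι X G where
  baseSet := P.dom
  isOpen_baseSet := P.isOpen_dom
  indexAt := P.index
  mem_baseSet_at := P.mem_dom_index
  coordChange i j x v := v * (P.val i x * (P.val j x)⁻¹)
  coordChange_self i x _ v := by simp
  continuousOn_coordChange i j := by
    rintro ⟨x, v⟩ ⟨⟨hi, hj⟩, -⟩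
    refine ContinuousAt.continuousWithinAt ?_
    refine continuousAt_snd.mul (ContinuousAt.comp (f := Prod.fst)
      (g := fun y => P.val i y * (P.val j y)⁻¹) ?_ continuousAt_fst)
    exact continuousAt_const.congr ((P.eventually_ratio_eq i j x hi hj).mono fun y hy => hy.symm)
  coordChange_comp i j k x _ v := by group

/-- Parallel transport exists: it is the monodromy of the covering space `P.core`, which is right
multiplication in the global fibre coordinate. -/
theorem exists_holonomy (P : LocalPotential X G ι) :
    ∃ H : ∀ x y : X, Path.Homotopic.Quotient x y → G,
      (∀ x y z (a : Path.Homotopic.Quotient x y) (b : Path.Homotopic.Quotient y z),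
        H x z (a.trans b) = H x y a * H y z b) ∧
      ∀ i x y (γ : Path x y), (∀ t, γ t ∈ P.dom i) →
        H x y ⟦γ⟧ₕ = (P.val i x)⁻¹ * P.val i y := by
  let _ : TopologicalSpace G := ⊥
  have : DiscreteTopology G := ⟨rfl⟩
  have cov : IsCoveringMap P.core.proj := FiberBundle.isCoveringMap (E := P.core.Fiber) (F := G)
  -- `pt x g` is the point over `x` with global coordinate `g`, and `crd` reads that coordinate
  let pt (x : X) (g : G) : P.core.proj ⁻¹' {x} := ⟨⟨x, (g * (P.val (P.index x) x)⁻¹ : G)⟩, rfl⟩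
  let crd (e : P.core.TotalSpace) : G := (show G from e.2) * P.val (P.index e.1) e.1
  have crd_pt (x : X) (g : G) : crd (pt x g).1 = g := inv_mul_cancel_right _ _
  have small {i : ι} {x y : X} (γ : Path x y) (h : ∀ t, γ t ∈ P.dom i) (g : G) :
      cov.monodromy ⟦γ⟧ₕ (pt x g) = pt y (g * ((P.val i x)⁻¹ * P.val i y)) := by
    have symm_apply (z : X) (v : G) :
        (P.core.localTriv i).toOpenPartialHomeomorph.symm (z, v) =
          ⟨z, v * (P.val i z * (P.val (P.index z) z)⁻¹)⟩ := rfl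
    -- the horizontal lift of `γ`
    let Γ : Path (pt x g).1 (pt y (g * ((P.val i x)⁻¹ * P.val i y))).1 :=
      { toFun := fun t =>
          (P.core.localTriv i).toOpenPartialHomeomorph.symm (γ t, g * (P.val i x)⁻¹)
        continuous_toFun := by
          refine (P.core.localTriv i).toOpenPartialHomeomorph.symm.continuousOn.comp_continuous
            (by fun_prop) fun t => ?_
          exact (P.core.mem_localTriv_target i _).2 (h t)
        source' := by
          rw [Path.source, symm_apply]
          exact congrArg (Bundle.TotalSpace.mk x)
            (show g * (P.val i x)⁻¹ * (P.val i x * (P.val (P.index x) x)⁻¹) =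
              (g * (P.val (P.index x) x)⁻¹ : G) by group)
        target' := by
          rw [Path.target, symm_apply]
          exact congrArg (Bundle.TotalSpace.mk y)
            (show g * (P.val i x)⁻¹ * (P.val i y * (P.val (P.index y) y)⁻¹) =
              (g * ((P.val i x)⁻¹ * P.val i y) * (P.val (P.index y) y)⁻¹ : G) by group) }
    exact cov.monodromy_eq_of_map_eq ⟦Γ⟧ₕ (congrArg Path.Homotopic.Quotient.mk (Path.ext rfl))
  have equivariant {x y : X} (a : Path.Homotopic.Quotient x y) :
      ∃ k, ∀ g, cov.monodromy a (pt x g) = pt y (g * k) := by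
    induction a using Path.Homotopic.Quotient.induction_of_local with
    | trans a b ha hb =>
      obtain ⟨k, hk⟩ := ha
      obtain ⟨l, hl⟩ := hb
      exact ⟨k * l, fun g => by rw [cov.monodromy_trans_apply, hk, hl, mul_assoc]⟩
    | small p =>
      exact ⟨_, (P.isOpen_dom _).mem_nhds (P.mem_dom_index p), fun γ h => ⟨_, small γ h⟩⟩
  choose H hH using fun (x y : X) (a : Path.Homotopic.Quotient x y) => equivariant a
  have eq_of_pt {x : X} {g g' : G} (h : pt x g = pt x g') : g = g' := by
    rw [← crd_pt x g, ← crd_pt x g', h]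
  refine ⟨H, fun x y z a b => ?_, fun i x y γ h => ?_⟩
  · have h := cov.monodromy_trans_apply a b (pt x 1)
    rw [hH, hH, hH, one_mul, one_mul] at h
    exact eq_of_pt h
  · have h' := small γ h 1
    rw [hH, one_mul, one_mul] at h'
    exact eq_of_pt h'

/-- The parallel transport of a local potential along a homotopy class of paths. -/
noncomputable def holonomy (P : LocalPotential X G ι) {x y : X} (a : Path.Homotopic.Quotient x y) :
    G :=
  P.exists_holonomy.choose x y a

variable (P : LocalPotential X G ι) {x y z : X}

theorem holonomy_trans (a : Path.Homotopic.Quotient x y) (b : Path.Homotopic.Quotient y z) :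
    P.holonomy (a.trans b) = P.holonomy a * P.holonomy b :=
  P.exists_holonomy.choose_spec.1 x y z a b

theorem holonomy_mk {i : ι} (γ : Path x y) (h : ∀ t, γ t ∈ P.dom i) :
    P.holonomy ⟦γ⟧ₕ = (P.val i x)⁻¹ * P.val i y :=
  P.exists_holonomy.choose_spec.2 i x y γ h

theorem holonomy_refl (x : X) : P.holonomy (Path.Homotopic.Quotient.refl x) = 1 := by
  have h := P.holonomy_trans (.refl x) (.refl x)
  rwa [Path.Homotopic.Quotient.refl_trans, left_eq_mul] at h

theorem holonomy_symm (a : Path.Homotopic.Quotient x y) :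
    P.holonomy a.symm = (P.holonomy a)⁻¹ := by
  rw [eq_inv_iff_mul_eq_one, ← holonomy_trans, Path.Homotopic.Quotient.symm_trans, holonomy_refl]

end LocalPotential

/-! ### Flat boxes -/

namespace HalfSpaceModel

variable {d : ℕ}

/-- The point that divides the segment from `a` to `b` in the flat model in the ratio
`t : 1 - t`. -/
def segment (a b : HalfSpaceModel d × ℝ) (t : I) : HalfSpaceModel d × ℝ :=
  (⟨(1 - (t : ℝ)) • (a.1 : EuclideanSpace ℝ (Fin d)) + (t : ℝ) • (b.1 : EuclideanSpace ℝ (Fin d)),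
    fun k hk => by
      have ha := mul_nonneg (one_minus_nonneg t) (a.1.2 k hk)
      have hb := mul_nonneg t.2.1 (b.1.2 k hk)
      simpa using add_nonneg ha hb⟩,
    (1 - (t : ℝ)) * a.2 + t * b.2)

theorem continuous_segment :
    Continuous fun q : (HalfSpaceModel d × ℝ) × (HalfSpaceModel d × ℝ) × I =>
      segment q.1 q.2.1 q.2.2 := by
  unfold segment
  exact Continuous.prodMk (Continuous.subtype_mk (by fun_prop) _) (by fun_prop)

@[simp]
theorem segment_zero (a b : HalfSpaceModel d × ℝ) : segment a b 0 = a := by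
  ext <;> simp [segment]

@[simp]
theorem segment_one (a b : HalfSpaceModel d × ℝ) : segment a b 1 = b := by
  ext <;> simp [segment]

@[simp]
theorem segment_self (a : HalfSpaceModel d × ℝ) (t : I) : segment a a t = a := by
  ext
  · simp [segment]; ring
  · simp [segment]; ring

theorem segment_mem_ball {c a b : HalfSpaceModel d × ℝ} {r : ℝ} (ha : a ∈ Metric.ball c r)
    (hb : b ∈ Metric.ball c r) (t : I) : segment a b t ∈ Metric.ball c r := by
  let incl (z : HalfSpaceModel d × ℝ) : EuclideanSpace ℝ (Fin d) × ℝ := (z.1, z.2)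
  have key : ∀ z, z ∈ Metric.ball c r ↔ incl z ∈ Metric.ball (incl c) r := fun z => Iff.rfl
  rw [key] at ha hb ⊢
  exact convex_ball (incl c) r ha hb (one_minus_nonneg t) t.2.1 (by ring)

end HalfSpaceModel

namespace OrientedHypersurface

variable {X : Type*} [TopologicalSpace X] {d : ℕ}

/-- A flat box in the domain of the flat chart `e`: an open set `B` that `e` maps onto a
convex set which meets both sides, described by what convexity gives for paths in `B`. -/
structure IsFlatBox (e : OpenPartialHomeomorph X (HalfSpaceModel d × ℝ)) (B : Set X) : Prop where
  isOpen : IsOpen B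
  subset_source : B ⊆ e.source
  homotopic : ∀ {x y : X} (γ γ' : Path x y), (∀ t, γ t ∈ B) → (∀ t, γ' t ∈ B) → γ.Homotopic γ'
  exists_segment : ∀ {x y : X}, x ∈ B → y ∈ B → ∃ τ : Path x y, (∀ t, τ t ∈ B) ∧
    ∀ t : I, (e (τ t)).2 = (1 - (t : ℝ)) * (e x).2 + t * (e y).2
  exists_pos : ∃ q ∈ B, 0 < (e q).2
  exists_neg : ∃ q ∈ B, (e q).2 < 0

theorem exists_isFlatBox {e : OpenPartialHomeomorph X (HalfSpaceModel d × ℝ)} {p : X}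
    (hp : p ∈ e.source) (he : (e p).2 = 0) {V : Set X} (hV : IsOpen V) (hpV : p ∈ V) :
    ∃ B ⊆ V, p ∈ B ∧ IsFlatBox e B := by
  obtain ⟨r, hr, hball⟩ : ∃ r > 0, Metric.ball (e p) r ⊆ e.target ∩ e.symm ⁻¹' V := by
    refine Metric.isOpen_iff.1 (e.isOpen_inter_preimage_symm hV) _ ⟨e.map_source hp, ?_⟩
    simpa [e.left_inv hp] using hpV
  have symm_mem {z} (hz : z ∈ Metric.ball (e p) r) :
      e.symm z ∈ e.source ∩ e ⁻¹' Metric.ball (e p) r := by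
    refine ⟨e.map_target (hball hz).1, ?_⟩
    rw [mem_preimage, e.right_inv (hball hz).1]
    exact hz
  have side (c : ℝ) (hc : |c| < r) :
      ∃ q ∈ e.source ∩ e ⁻¹' Metric.ball (e p) r, (e q).2 = c := by
    have hz : ((e p).1, c) ∈ Metric.ball (e p) r := by
      rw [Metric.mem_ball, Prod.dist_eq, dist_self, he, Real.dist_eq, sub_zero]
      exact max_lt hr hc
    exact ⟨_, symm_mem hz, by rw [e.right_inv (hball hz).1]⟩
  refine ⟨e.source ∩ e ⁻¹' Metric.ball (e p) r, fun x hx => ?_, ⟨hp, Metric.mem_ball_self hr⟩,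
    e.isOpen_inter_preimage Metric.isOpen_ball, inter_subset_left, fun {x y} γ γ' h h' => ?_,
    fun {x y} hx hy => ?_, ?_, ?_⟩
  · simpa [e.left_inv hx.1] using (hball hx.2).2
  · have cont {δ : Path x y} (hδ : ∀ t, δ t ∈ e.source ∩ e ⁻¹' Metric.ball (e p) r) :
        Continuous fun t => e (δ t) :=
      e.continuousOn.comp_continuous δ.continuous fun t => (hδ t).1
    refine ⟨{
      toFun := fun q => e.symm (HalfSpaceModel.segment (e (γ q.2)) (e (γ' q.2)) q.1)
      continuous_toFun := ?_
      map_zero_left := fun t => ?_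
      map_one_left := fun t => ?_
      prop' := fun s t ht => ?_ }⟩
    · refine e.continuousOn_symm.comp_continuous ?_ fun q =>
        (hball (HalfSpaceModel.segment_mem_ball (h _).2 (h' _).2 _)).1
      exact HalfSpaceModel.continuous_segment.comp
        (((cont h).comp continuous_snd).prodMk
          (((cont h').comp continuous_snd).prodMk continuous_fst))
    · simpa using e.left_inv (h t).1
    · simpa using e.left_inv (h' t).1
    · have : γ t = γ' t := by rcases ht with rfl | rfl <;> simp
      simpa [← this] using e.left_inv (h t).1
  · have hmem (t : I) := HalfSpaceModel.segment_mem_ball hx.2 hy.2 t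
    refine ⟨{
      toFun := fun t => e.symm (HalfSpaceModel.segment (e x) (e y) t)
      continuous_toFun := ?_
      source' := by simpa using e.left_inv hx.1
      target' := by simpa using e.left_inv hy.1 }, fun t => symm_mem (hmem t), fun t => ?_⟩
    · refine e.continuousOn_symm.comp_continuous ?_ fun t => (hball (hmem t)).1
      exact HalfSpaceModel.continuous_segment.comp
        (continuous_const.prodMk (continuous_const.prodMk continuous_id))
    · change (e (e.symm _)).2 = _
      rw [e.right_inv (hball (hmem t)).1]
      rfl
  · obtain ⟨q, hq, h⟩ := side (r / 2) (by rw [abs_of_pos (half_pos hr)]; linarith)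
    exact ⟨q, hq, by linarith⟩
  · obtain ⟨q, hq, h⟩ := side (-(r / 2)) (by rw [abs_neg, abs_of_pos (half_pos hr)]; linarith)
    exact ⟨q, hq, by linarith⟩

end OrientedHypersurface

/-! ### Crossings and words -/

section Unions

variable {X : Type*} [TopologicalSpace X] {d n : ℕ} (U : Fin n → OrientedHypersurface X d)

theorem isClosed_unionAll : IsClosed (unionAll U) :=
  isClosed_iUnion_of_finite fun i => (U i).isClosed_carrier

theorem isClosed_unionExcept (j : Fin n) : IsClosed (unionExcept U j) :=
  isClosed_iUnion_of_finite fun i => isClosed_iUnion_of_finite fun _ => (U i).isClosed_carrier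

variable {U}

theorem mem_unionAll {x : X} : x ∈ unionAll U ↔ ∃ i, x ∈ (U i).carrier :=
  mem_iUnion

theorem mem_unionExcept {j : Fin n} {x : X} :
    x ∈ unionExcept U j ↔ ∃ i, i ≠ j ∧ x ∈ (U i).carrier := by
  simp [unionExcept]

theorem notMem_unionAll_iff {j : Fin n} {x : X} :
    x ∉ unionAll U ↔ x ∉ unionExcept U j ∧ x ∉ (U j).carrier := by
  rw [mem_unionAll, mem_unionExcept]
  push Not
  refine ⟨fun h => ⟨fun i _ => h i, h j⟩, fun h i => ?_⟩
  by_cases hij : i = j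
  · exact hij ▸ h.2
  · exact h.1 i hij

theorem eq_of_mem_carrier (hdisj : ∀ i j : Fin n, i ≠ j → (U i).carrier ∩ (U j).carrier = ∅)
    {i j : Fin n} {x : X} (hi : x ∈ (U i).carrier) (hj : x ∈ (U j).carrier) : i = j := by
  by_contra hij
  exact (hdisj i j hij).subset ⟨hi, hj⟩

theorem notMem_unionExcept (hdisj : ∀ i j : Fin n, i ≠ j → (U i).carrier ∩ (U j).carrier = ∅)
    {i : Fin n} {x : X} (hi : x ∈ (U i).carrier) : x ∉ unionExcept U i := by
  rw [mem_unionExcept]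
  rintro ⟨j, hji, hj⟩
  exact hji (eq_of_mem_carrier hdisj hj hi)

end Unions

namespace OrientedHypersurface

variable {X : Type*} [TopologicalSpace X] {d : ℕ} {U : OrientedHypersurface X d}
  {x y x' y' : X} {γ : Path x y} {γ' : Path x' y'} {t : I}

theorem CrossesPos.mem_carrier (h : U.CrossesPos γ t) : γ t ∈ U.carrier :=
  h.choose_spec.2.2.1

theorem CrossesNeg.mem_carrier (h : U.CrossesNeg γ t) : γ t ∈ U.carrier :=
  h.choose_spec.2.2.1

theorem eventually_notMem_carrier {e : OpenPartialHomeomorph X (HalfSpaceModel d × ℝ)}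
    (he : e ∈ U.charts) {l : Filter I} (hl : l ≤ 𝓝 t) (ht : γ t ∈ e.source)
    (h : ∀ᶠ s in l, (e (γ s)).2 ≠ 0) : ∀ᶠ s in l, γ s ∉ U.carrier := by
  filter_upwards [h, hl (γ.continuous.continuousAt.eventually (e.open_source.mem_nhds ht))]
    with s hs hs'
  exact fun hU => hs ((U.mem_carrier_iff e he _ hs').1 hU)

theorem CrossesPos.eventually_notMem (h : U.CrossesPos γ t) :
    ∀ᶠ s in 𝓝[≠] t, γ s ∉ U.carrier := by
  obtain ⟨e, he, ht, -, hl, hr⟩ := h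
  refine eventually_notMem_carrier he nhdsWithin_le_nhds ht ?_
  rw [← nhdsLT_sup_nhdsGT, eventually_sup]
  exact ⟨hl.mono fun s => ne_of_lt, hr.mono fun s => ne_of_gt⟩

theorem CrossesNeg.eventually_notMem (h : U.CrossesNeg γ t) :
    ∀ᶠ s in 𝓝[≠] t, γ s ∉ U.carrier := by
  obtain ⟨e, he, ht, -, hl, hr⟩ := h
  refine eventually_notMem_carrier he nhdsWithin_le_nhds ht ?_
  rw [← nhdsLT_sup_nhdsGT, eventually_sup]
  exact ⟨hl.mono fun s => ne_of_gt, hr.mono fun s => ne_of_lt⟩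

/-- A positive and a negative crossing are exclusive. The sides are compared just before `t`, which
has a meaning only if `t` is not the start of the curve. -/
theorem CrossesPos.not_crossesNeg (h : U.CrossesPos γ t) (ht : 0 < t) : ¬U.CrossesNeg γ t := by
  rintro ⟨e', he', ht', -, hl', -⟩
  obtain ⟨e, he, hte, hU, hl, -⟩ := h
  have : (𝓝[<] t).NeBot := nhdsLT_neBot_of_exists_lt ⟨0, ht⟩
  have hside := γ.continuous.continuousAt.eventually (U.side_compatible e he e' he' _ hU hte ht')
  obtain ⟨s, hs, hs', hss⟩ := (hl.and (hl'.and (nhdsWithin_le_nhds hside))).exists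
  exact lt_asymm hs (hss.2 hs')

theorem CrossesPos.comp {φ : I → I} (h : U.CrossesPos γ (φ t))
    (hlt : Tendsto φ (𝓝[<] t) (𝓝[<] (φ t))) (hgt : Tendsto φ (𝓝[>] t) (𝓝[>] (φ t)))
    (heq : ∀ᶠ s in 𝓝 t, γ' s = γ (φ s)) : U.CrossesPos γ' t := by
  obtain ⟨e, he, hte, hU, hl, hr⟩ := h
  refine ⟨e, he, heq.self_of_nhds ▸ hte, heq.self_of_nhds ▸ hU, ?_, ?_⟩
  · filter_upwards [nhdsWithin_le_nhds heq, hlt.eventually hl] with s hs hs'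
    rwa [hs]
  · filter_upwards [nhdsWithin_le_nhds heq, hgt.eventually hr] with s hs hs'
    rwa [hs]

theorem CrossesNeg.comp {φ : I → I} (h : U.CrossesNeg γ (φ t))
    (hlt : Tendsto φ (𝓝[<] t) (𝓝[<] (φ t))) (hgt : Tendsto φ (𝓝[>] t) (𝓝[>] (φ t)))
    (heq : ∀ᶠ s in 𝓝 t, γ' s = γ (φ s)) : U.CrossesNeg γ' t := by
  obtain ⟨e, he, hte, hU, hl, hr⟩ := h
  refine ⟨e, he, heq.self_of_nhds ▸ hte, heq.self_of_nhds ▸ hU, ?_, ?_⟩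
  · filter_upwards [nhdsWithin_le_nhds heq, hlt.eventually hl] with s hs hs'
    rwa [hs]
  · filter_upwards [nhdsWithin_le_nhds heq, hgt.eventually hr] with s hs hs'
    rwa [hs]

end OrientedHypersurface

section GeneralPosition

variable {X : Type*} [TopologicalSpace X] {d n : ℕ} {U : Fin n → OrientedHypersurface X d}
  {x y z : X}

/-- Affine reparametrizations of the unit interval, clamped to it, preserve the two sides of a time
that they map to the interior. -/
theorem tendsto_projIcc_affine {a b : ℝ} (ha : 0 < a) {t : I} (h₀ : 0 < a * t + b)
    (h₁ : a * t + b < 1) :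
    Tendsto (fun s : I => projIcc (0 : ℝ) 1 zero_le_one (a * s + b)) (𝓝[<] t)
      (𝓝[<] (projIcc (0 : ℝ) 1 zero_le_one (a * t + b))) ∧
    Tendsto (fun s : I => projIcc (0 : ℝ) 1 zero_le_one (a * s + b)) (𝓝[>] t)
      (𝓝[>] (projIcc (0 : ℝ) 1 zero_le_one (a * t + b))) := by
  have hcont : Continuous fun s : I => projIcc (0 : ℝ) 1 zero_le_one (a * s + b) :=
    continuous_projIcc.comp (by fun_prop)
  have hlt (s : I) (hs : s < t) : a * (s : ℝ) + b < a * t + b := by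
    have : (s : ℝ) < t := hs
    gcongr
  have hgt (s : I) (hs : t < s) : a * (t : ℝ) + b < a * s + b := by
    have : (t : ℝ) < s := hs
    gcongr
  constructor <;> refine tendsto_nhdsWithin_iff.2
    ⟨hcont.continuousAt.tendsto.mono_left nhdsWithin_le_nhds, ?_⟩
  · filter_upwards [self_mem_nhdsWithin] with s hs
    rw [mem_Iio, ← Subtype.coe_lt_coe, coe_projIcc, coe_projIcc]
    have := hlt s hs
    rw [min_eq_right h₁.le, max_eq_right h₀.le, max_lt_iff]
    exact ⟨h₀, min_lt_of_right_lt this⟩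
  · filter_upwards [self_mem_nhdsWithin] with s hs
    rw [mem_Ioi, ← Subtype.coe_lt_coe, coe_projIcc, coe_projIcc]
    have := hgt s hs
    rw [min_eq_right h₁.le, max_eq_right h₀.le]
    exact lt_max_of_lt_right (lt_min h₁ this)

theorem InGeneralPosition.trans {γ : Path x y} {γ' : Path y z} (h : InGeneralPosition U γ)
    (h' : InGeneralPosition U γ') : InGeneralPosition U (γ.trans γ') := by
  have extend_eq {a b : X} (δ : Path a b) (r : ℝ) :
      δ.extend r = δ (projIcc (0 : ℝ) 1 zero_le_one r) := rfl
  have apply_left (s : I) (hs : (s : ℝ) ≤ 1 / 2) :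
      γ.trans γ' s = γ (projIcc (0 : ℝ) 1 zero_le_one (2 * s + 0)) := by
    rw [add_zero, ← extend_eq]
    exact if_pos hs
  have apply_right (s : I) (hs : 1 / 2 < (s : ℝ)) :
      γ.trans γ' s = γ' (projIcc (0 : ℝ) 1 zero_le_one (2 * s + -1)) := by
    rw [← sub_eq_add_neg, ← extend_eq]
    exact if_neg hs.not_ge
  have ne_endpoint {a b : X} {δ : Path a b} (hδ : InGeneralPosition U δ) {i : Fin n} {r : ℝ}
      (hr : δ (projIcc (0 : ℝ) 1 zero_le_one r) ∈ (U i).carrier) : 0 < r ∧ r < 1 := by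
    constructor
    · by_contra! hr'
      rw [projIcc_of_le_left _ hr'] at hr
      exact hδ.1 (mem_unionAll.2 ⟨i, by simpa using hr⟩)
    · by_contra! hr'
      rw [projIcc_of_right_le _ hr'] at hr
      exact hδ.2.1 (mem_unionAll.2 ⟨i, by simpa using hr⟩)
  refine ⟨h.1, h'.2.1, fun i t ht => ?_⟩
  rcases le_or_gt (t : ℝ) (1 / 2) with hle | hlt
  · rw [apply_left t hle] at ht
    obtain ⟨h₀, h₁⟩ := ne_endpoint h ht
    obtain ⟨hl, hr⟩ := tendsto_projIcc_affine two_pos h₀ h₁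
    have heq : ∀ᶠ s in 𝓝 t, γ.trans γ' s = γ (projIcc (0 : ℝ) 1 zero_le_one (2 * s + 0)) := by
      filter_upwards [continuous_subtype_val.continuousAt.eventually_lt
        (continuousAt_const (y := (1 / 2 : ℝ))) (by linarith : (t : ℝ) < 1 / 2)] with s hs
      exact apply_left s hs.le
    exact (h.2.2 i _ ht).imp (fun hc => hc.comp hl hr heq) fun hc => hc.comp hl hr heq
  · rw [apply_right t hlt] at ht
    obtain ⟨h₀, h₁⟩ := ne_endpoint h' ht
    obtain ⟨hl, hr⟩ := tendsto_projIcc_affine two_pos h₀ h₁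
    have heq : ∀ᶠ s in 𝓝 t, γ.trans γ' s = γ' (projIcc (0 : ℝ) 1 zero_le_one (2 * s + -1)) := by
      filter_upwards [(continuousAt_const (y := (1 / 2 : ℝ))).eventually_lt
        continuous_subtype_val.continuousAt hlt] with s hs
      exact apply_right s hs
    exact (h'.2.2 i _ ht).imp (fun hc => hc.comp hl hr heq) fun hc => hc.comp hl hr heq

theorem inGeneralPosition_of_forall_notMem {γ : Path x y} (h : ∀ t, γ t ∉ unionAll U) :
    InGeneralPosition U γ :=
  ⟨by simpa using h 0, by simpa using h 1, fun i t ht => (h t (mem_unionAll.2 ⟨i, ht⟩)).elim⟩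

theorem InGeneralPosition.eventually_notMem_unionAll
    (hdisj : ∀ i j : Fin n, i ≠ j → (U i).carrier ∩ (U j).carrier = ∅) {γ : Path x y}
    (h : InGeneralPosition U γ) (t : I) : ∀ᶠ s in 𝓝[≠] t, γ s ∉ unionAll U := by
  by_cases ht : γ t ∈ unionAll U
  · obtain ⟨i, hi⟩ := mem_unionAll.1 ht
    have hexc : ∀ᶠ s in 𝓝[≠] t, γ s ∉ unionExcept U i :=
      nhdsWithin_le_nhds (γ.continuous.continuousAt.eventually
        ((isClosed_unionExcept U i).isOpen_compl.mem_nhds (notMem_unionExcept hdisj hi)))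
    have hi' : ∀ᶠ s in 𝓝[≠] t, γ s ∉ (U i).carrier :=
      (h.2.2 i t hi).elim (fun hc => hc.eventually_notMem) fun hc => hc.eventually_notMem
    filter_upwards [hexc, hi'] with s hs hs'
    exact notMem_unionAll_iff.2 ⟨hs, hs'⟩
  · exact nhdsWithin_le_nhds (γ.continuous.continuousAt.eventually
      ((isClosed_unionAll U).isOpen_compl.mem_nhds ht))

theorem InGeneralPosition.finite_crossings
    (hdisj : ∀ i j : Fin n, i ≠ j → (U i).carrier ∩ (U j).carrier = ∅) {γ : Path x y}
    (h : InGeneralPosition U γ) : {t | γ t ∈ unionAll U}.Finite := by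
  by_contra hinf
  obtain ⟨t, -, ht⟩ := Set.Infinite.exists_accPt_of_subset_isCompact hinf isCompact_univ
    (subset_univ _)
  exact (accPt_iff_frequently_nhdsNE.1 ht) (h.eventually_notMem_unionAll hdisj t)

theorem IsLetterAt.mem_carrier {γ : Path x y} {t : I} {l : Fin n × Bool}
    (h : IsLetterAt U γ t l) : γ t ∈ (U l.1).carrier :=
  h.elim (fun h => h.2.mem_carrier) fun h => h.2.mem_carrier

theorem InGeneralPosition.letter_unique
    (hdisj : ∀ i j : Fin n, i ≠ j → (U i).carrier ∩ (U j).carrier = ∅) {γ : Path x y}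
    (h : InGeneralPosition U γ) {t : I} {l l' : Fin n × Bool} (hl : IsLetterAt U γ t l)
    (hl' : IsLetterAt U γ t l') : l = l' := by
  have ht : 0 < t := by
    refine unitInterval.pos_iff_ne_zero.2 ?_
    rintro rfl
    exact h.1 (mem_unionAll.2 ⟨l.1, by simpa using hl.mem_carrier⟩)
  obtain ⟨i, b⟩ := l
  obtain ⟨i', b'⟩ := l'
  obtain rfl : i = i' := eq_of_mem_carrier hdisj hl.mem_carrier hl'.mem_carrier
  rcases hl with ⟨hb, hc⟩ | ⟨hb, hc⟩ <;> rcases hl' with ⟨hb', hc'⟩ | ⟨hb', hc'⟩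
  · exact congrArg (Prod.mk i) (hb.trans hb'.symm)
  · exact (hc.not_crossesNeg ht hc').elim
  · exact (hc'.not_crossesNeg ht hc).elim
  · exact congrArg (Prod.mk i) (hb.trans hb'.symm)

theorem InGeneralPosition.existsUnique_isCrossingWord
    (hdisj : ∀ i j : Fin n, i ≠ j → (U i).carrier ∩ (U j).carrier = ∅) {γ : Path x y}
    (h : InGeneralPosition U γ) : ∃! w, IsCrossingWord U γ w := by
  have hletter (t : I) (ht : γ t ∈ unionAll U) : ∃ l, IsLetterAt U γ t l := by
    obtain ⟨i, hi⟩ := mem_unionAll.1 ht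
    rcases h.2.2 i t hi with hc | hc
    · exact ⟨(i, true), Or.inl ⟨rfl, hc⟩⟩
    · exact ⟨(i, false), Or.inr ⟨rfl, hc⟩⟩
  have hword (ts : List I) (hts : ∀ t ∈ ts, γ t ∈ unionAll U) :
      ∃ w, List.Forall₂ (IsLetterAt U γ) ts w := by
    induction ts with
    | nil => exact ⟨[], .nil⟩
    | cons t ts ih =>
      obtain ⟨l, hl⟩ := hletter t (hts t List.mem_cons_self)
      obtain ⟨w, hw⟩ := ih fun s hs => hts s (List.mem_cons_of_mem _ hs)
      exact ⟨l :: w, .cons hl hw⟩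
  have hfin := h.finite_crossings hdisj
  have hmem (t : I) : t ∈ hfin.toFinset.sort ↔ γ t ∈ unionAll U := by simp
  obtain ⟨w, hw⟩ := hword hfin.toFinset.sort fun t => (hmem t).1
  refine ⟨w, ⟨h, _, (Finset.sortedLT_sort _).pairwise, hmem, hw⟩, ?_⟩
  rintro w' ⟨-, ts, hts, hts', hw'⟩
  have hts_eq : ts = hfin.toFinset.sort := by
    refine List.Perm.eq_of_pairwise (le := (· < ·))
      (fun a b _ _ hab hba => (lt_asymm hab hba).elim) hts (Finset.sortedLT_sort _).pairwise ?_
    refine (List.perm_ext_iff_of_nodup (hts.imp ne_of_lt) (Finset.sort_nodup ..)).2 fun t => ?_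
    rw [hts', hmem]
  subst hts_eq
  exact List.right_unique_forall₂' (R := IsLetterAt U γ) (fun _ _ _ => h.letter_unique hdisj) hw' hw

end GeneralPosition

/-! ### Curves in general position up to homotopy -/

section GeneralPosition

variable {X : Type*} [TopologicalSpace X] {d n : ℕ} {U : Fin n → OrientedHypersurface X d}
  {x y z : X}

theorem Path.Homotopic.Quotient.symm_trans_rev (a : Path.Homotopic.Quotient x y)
    (b : Path.Homotopic.Quotient y z) : (a.trans b).symm = b.symm.trans a.symm := by
  induction a with | mk α
  induction b with | mk β
  exact congrArg Path.Homotopic.Quotient.mk (Path.trans_symm α β)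

/-- A chord of a flat box whose ends are off the hypersurface crosses it at most once, since the
transverse coordinate is affine along the chord. -/
theorem inGeneralPosition_of_segment {i : Fin n}
    {e : OpenPartialHomeomorph X (HalfSpaceModel d × ℝ)} (he : e ∈ (U i).charts) {τ : Path x y}
    (hsource : ∀ t, τ t ∈ e.source) (hexc : ∀ t, τ t ∉ unionExcept U i)
    (haff : ∀ t : I, (e (τ t)).2 = (1 - (t : ℝ)) * (e x).2 + t * (e y).2)
    (hx : x ∉ unionAll U) (hy : y ∉ unionAll U) : InGeneralPosition U τ := by
  refine ⟨hx, hy, fun j t ht => ?_⟩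
  obtain rfl : j = i := by
    by_contra hji
    exact hexc t (mem_unionExcept.2 ⟨j, hji, ht⟩)
  have h_zero : (1 - (t : ℝ)) * (e x).2 + t * (e y).2 = 0 := by
    rw [← haff, ← (U j).mem_carrier_iff e he _ (hsource t)]
    exact ht
  have hx' : (e x).2 ≠ 0 := fun h => hx (mem_unionAll.2
    ⟨j, ((U j).mem_carrier_iff e he _ (by simpa using hsource 0)).2 h⟩)
  have hdiff (s : I) : (e (τ s)).2 = ((s : ℝ) - t) * ((e y).2 - (e x).2) := by
    rw [haff]
    linear_combination h_zero
  have hlt (s : I) (hs : s < t) : (s : ℝ) - t < 0 := sub_neg.2 hs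
  have hgt (s : I) (hs : t < s) : 0 < (s : ℝ) - t := sub_pos.2 hs
  have hne : (e x).2 ≠ (e y).2 := fun h => hx' (by rw [← h] at h_zero; linarith)
  rcases lt_or_gt_of_ne hne with h | h
  · refine Or.inl ⟨e, he, hsource t, ht, ?_, ?_⟩ <;> filter_upwards [self_mem_nhdsWithin] with s hs
    · rw [hdiff]
      exact mul_neg_of_neg_of_pos (hlt s hs) (sub_pos.2 h)
    · rw [hdiff]
      exact mul_pos (hgt s hs) (sub_pos.2 h)
  · refine Or.inr ⟨e, he, hsource t, ht, ?_, ?_⟩ <;> filter_upwards [self_mem_nhdsWithin] with s hs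
    · rw [hdiff]
      exact mul_pos_of_neg_of_neg (hlt s hs) (sub_neg.2 h)
    · rw [hdiff]
      exact mul_neg_of_pos_of_neg (hgt s hs) (sub_neg.2 h)

/-- Around each point of a hypersurface there is a flat box that avoids all the other ones. -/
theorem exists_isFlatBox_avoiding
    (hdisj : ∀ i j : Fin n, i ≠ j → (U i).carrier ∩ (U j).carrier = ∅) {i : Fin n} {p : X}
    (hp : p ∈ (U i).carrier) : ∃ e ∈ (U i).charts, ∃ B ⊆ (unionExcept U i)ᶜ, p ∈ B ∧
      OrientedHypersurface.IsFlatBox e B := by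
  obtain ⟨e, he, hpe⟩ := (U i).exists_chart p hp
  exact ⟨e, he, OrientedHypersurface.exists_isFlatBox hpe (((U i).mem_carrier_iff e he p hpe).1 hp)
    (isClosed_unionExcept U i).isOpen_compl (notMem_unionExcept hdisj hp)⟩

theorem notMem_unionAll_of_ne_zero {i : Fin n}
    {e : OpenPartialHomeomorph X (HalfSpaceModel d × ℝ)} (he : e ∈ (U i).charts)
    (hx : x ∈ e.source) (hexc : x ∉ unionExcept U i) (h : (e x).2 ≠ 0) : x ∉ unionAll U :=
  notMem_unionAll_iff.2 ⟨hexc, fun hU => h (((U i).mem_carrier_iff e he x hx).1 hU)⟩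

/-- Every point can be pushed off the hypersurfaces. -/
theorem exists_push_off
    (hdisj : ∀ i j : Fin n, i ≠ j → (U i).carrier ∩ (U j).carrier = ∅) (p : X) :
    ∃ (q : X) (δ : Path p q), ∀ t, 0 < t → δ t ∉ unionAll U := by
  by_cases hp : p ∈ unionAll U
  · obtain ⟨i, hi⟩ := mem_unionAll.1 hp
    obtain ⟨e, he, B, hB, hpB, hbox⟩ := exists_isFlatBox_avoiding hdisj hi
    obtain ⟨q, hq, hq_pos⟩ := hbox.exists_pos
    obtain ⟨τ, hτ, haff⟩ := hbox.exists_segment hpB hq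
    refine ⟨q, τ, fun t ht =>
      notMem_unionAll_of_ne_zero he (hbox.subset_source (hτ t)) (hB (hτ t)) ?_⟩
    rw [haff, ((U i).mem_carrier_iff e he p (hbox.subset_source hpB)).1 hi, mul_zero, zero_add]
    exact (mul_pos (unitInterval.coe_pos.2 ht) hq_pos).ne'
  · exact ⟨p, Path.refl p, fun _ _ => hp⟩

/-- A path that leaves the hypersurfaces at once splits into a path in a given neighbourhood of its
start and a path off the hypersurfaces. -/
theorem exists_split_push_off {δ : Path x y} (hδ : ∀ t, 0 < t → δ t ∉ unionAll U) {B : Set X}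
    (hB : IsOpen B) (hx : x ∈ B) : ∃ q ∉ unionAll U, ∃ (α : Path x q) (β : Path q y),
      ⟦δ⟧ₕ = (⟦α⟧ₕ).trans ⟦β⟧ₕ ∧ (∀ t, α t ∈ B) ∧ ∀ t, β t ∉ unionAll U := by
  have hnhds : δ ⁻¹' B ∈ 𝓝 (0 : I) :=
    (hB.preimage δ.continuous).mem_nhds (by simpa using hx)
  obtain ⟨ε, hε, hsub⟩ := (nhds_bot_basis_Iic (α := I)).mem_iff.1 hnhds
  have hε : 0 < ε := hε
  obtain ⟨α, β, hαβ, hα, hβ⟩ := δ.exists_mk_eq_trans ε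
  refine ⟨δ ε, hδ ε hε, α, β, hαβ, fun t => ?_, fun t => ?_⟩
  · obtain ⟨u, hu, h⟩ := hα t
    exact h ▸ hsub hu
  · obtain ⟨u, hu, h⟩ := hβ t
    exact h ▸ hδ u (hε.trans_le hu)

/-- Every curve with endpoints off the hypersurfaces is homotopic to one in general position. By
induction on small paths, the following holds for every path: when its endpoints are pushed off the
hypersurfaces, it becomes homotopic to a curve in general position. Within a flat box, that curve is
a chord. -/
theorem exists_homotopic_inGeneralPosition
    (hdisj : ∀ i j : Fin n, i ≠ j → (U i).carrier ∩ (U j).carrier = ∅)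
    (hx : x ∉ unionAll U) (hy : y ∉ unionAll U) (γ : Path x y) :
    ∃ γ' : Path x y, γ.Homotopic γ' ∧ InGeneralPosition U γ' := by
  choose q δ hδ using exists_push_off hdisj
  have hδ' {z : X} (hz : z ∉ unionAll U) (t : I) : δ z t ∉ unionAll U := by
    rcases (zero_le : 0 ≤ t).eq_or_lt with rfl | ht
    · simpa using hz
    · exact hδ z t ht
  have key {x y : X} (a : Path.Homotopic.Quotient x y) :
      ∃ γ', ⟦γ'⟧ₕ = (⟦δ x⟧ₕ).symm.trans (a.trans ⟦δ y⟧ₕ) ∧ InGeneralPosition U γ' := by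
    induction a using Path.Homotopic.Quotient.induction_of_local with
    | @trans x y z a b ha hb =>
      obtain ⟨α, hα, hα'⟩ := ha
      obtain ⟨β, hβ, hβ'⟩ := hb
      refine ⟨α.trans β, ?_, hα'.trans hβ'⟩
      rw [Path.Homotopic.Quotient.mk_trans, hα, hβ]
      simp only [Path.Homotopic.Quotient.trans_assoc]
      rw [← Path.Homotopic.Quotient.trans_assoc (⟦δ y⟧ₕ) (⟦δ y⟧ₕ).symm,
        Path.Homotopic.Quotient.trans_symm, Path.Homotopic.Quotient.refl_trans]
    | small p =>
      by_cases hp : p ∈ unionAll U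
      · obtain ⟨i, hi⟩ := mem_unionAll.1 hp
        obtain ⟨e, he, B, hB, hpB, hbox⟩ := exists_isFlatBox_avoiding hdisj hi
        refine ⟨B, hbox.isOpen.mem_nhds hpB, fun {x y} γ hγ => ?_⟩
        have hxB : x ∈ B := by simpa using hγ 0
        have hyB : y ∈ B := by simpa using hγ 1
        obtain ⟨x', hx', αx, βx, hδx, hαx, hβx⟩ := exists_split_push_off (hδ x) hbox.isOpen hxB
        obtain ⟨y', hy', αy, βy, hδy, hαy, hβy⟩ := exists_split_push_off (hδ y) hbox.isOpen hyB
        obtain ⟨τ, hτ, haff⟩ := hbox.exists_segment (x := x') (y := y') (by simpa using hαx 1)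
          (by simpa using hαy 1)
        have hgp : InGeneralPosition U τ := inGeneralPosition_of_segment he
          (fun t => hbox.subset_source (hτ t)) (fun t => hB (hτ t)) haff hx' hy'
        have hτ_eq := Path.Homotopic.Quotient.eq.2 (hbox.homotopic τ (αx.symm.trans (γ.trans αy)) hτ
          (Path.trans_mem (Path.symm_mem hαx) (Path.trans_mem hγ hαy)))
        refine ⟨βx.symm.trans (τ.trans βy), ?_,
          (inGeneralPosition_of_forall_notMem (Path.symm_mem (S := (unionAll U)ᶜ) hβx)).trans
            (hgp.trans (inGeneralPosition_of_forall_notMem hβy))⟩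
        rw [Path.Homotopic.Quotient.mk_trans, Path.Homotopic.Quotient.mk_trans, hτ_eq, hδx, hδy,
          Path.Homotopic.Quotient.symm_trans_rev]
        simp only [Path.Homotopic.Quotient.mk_trans, Path.Homotopic.Quotient.mk_symm,
          Path.Homotopic.Quotient.trans_assoc]
      · refine ⟨(unionAll U)ᶜ, (isClosed_unionAll U).isOpen_compl.mem_nhds hp,
          fun {x y} γ hγ => ⟨(δ x).symm.trans (γ.trans (δ y)), rfl, ?_⟩⟩
        exact inGeneralPosition_of_forall_notMem (Path.trans_mem (S := (unionAll U)ᶜ)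
          (Path.symm_mem (S := (unionAll U)ᶜ) (hδ' (by simpa using hγ 0)))
          (Path.trans_mem hγ (hδ' (by simpa using hγ 1))))
  obtain ⟨γ', hγ', hgp⟩ := key ⟦γ⟧ₕ
  refine ⟨(δ x).trans (γ'.trans (δ y).symm), Path.Homotopic.Quotient.eq.1 ?_,
    (inGeneralPosition_of_forall_notMem (hδ' hx)).trans (hgp.trans
      (inGeneralPosition_of_forall_notMem (Path.symm_mem (S := (unionAll U)ᶜ) (hδ' hy))))⟩
  rw [Path.Homotopic.Quotient.mk_trans, Path.Homotopic.Quotient.mk_trans, hγ']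
  simp only [Path.Homotopic.Quotient.mk_symm, Path.Homotopic.Quotient.trans_assoc,
    Path.Homotopic.Quotient.trans_symm, Path.Homotopic.Quotient.trans_refl]
  rw [← Path.Homotopic.Quotient.trans_assoc, Path.Homotopic.Quotient.trans_symm,
    Path.Homotopic.Quotient.refl_trans]

end GeneralPosition

/-! ### The word of a homotopy class -/

section Holonomy

variable {X : Type*} [TopologicalSpace X] {d n : ℕ} {U : Fin n → OrientedHypersurface X d}
  {x y z : X}

open Classical in
/-- The potential of the `i`-th hypersurface in a flat chart: it is `u_i` on the positive side and
`1` on the rest of the chart. -/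
noncomputable def sidePotential (i : Fin n) (e : OpenPartialHomeomorph X (HalfSpaceModel d × ℝ))
    (x : X) : FreeGroup (Fin n) :=
  if 0 < (e x).2 then FreeGroup.of i else 1

theorem sidePotential_of_pos {i : Fin n} {e : OpenPartialHomeomorph X (HalfSpaceModel d × ℝ)}
    (h : 0 < (e x).2) : sidePotential i e x = FreeGroup.of i :=
  if_pos h

theorem sidePotential_of_neg {i : Fin n} {e : OpenPartialHomeomorph X (HalfSpaceModel d × ℝ)}
    (h : (e x).2 < 0) : sidePotential i e x = 1 :=
  if_neg h.not_gt

theorem eventually_sidePotential_eq {i : Fin n}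
    {e : OpenPartialHomeomorph X (HalfSpaceModel d × ℝ)} (he : e ∈ (U i).charts)
    (hx : x ∈ e.source) (hU : x ∉ (U i).carrier) :
    ∀ᶠ y in 𝓝 x, sidePotential i e y = sidePotential i e x := by
  have hcont : ContinuousAt (fun y => (e y).2) x := continuousAt_snd.comp (e.continuousAt hx)
  have hne : (e x).2 ≠ 0 := fun h => hU (((U i).mem_carrier_iff e he x hx).2 h)
  rcases lt_or_gt_of_ne hne with h | h
  · filter_upwards [hcont.eventually_lt continuousAt_const h] with y hy
    rw [sidePotential_of_neg h, sidePotential_of_neg hy]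
  · filter_upwards [continuousAt_const.eventually_lt hcont h] with y hy
    rw [sidePotential_of_pos h, sidePotential_of_pos hy]

/-- The domains of the local potentials: `none` stands for the complement of all the hypersurfaces,
and each flat chart of the `i`-th one is restricted to the complement of the others. -/
def potentialDomain (U : Fin n → OrientedHypersurface X d) :
    Option (Σ i, (U i).charts) → Set X
  | none => (unionAll U)ᶜ
  | some k => k.2.1.source ∩ (unionExcept U k.1)ᶜ

/-- The local potentials, on the domains `potentialDomain U`. -/
noncomputable def potentialValue (U : Fin n → OrientedHypersurface X d) :
    Option (Σ i, (U i).charts) → X → FreeGroup (Fin n)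
  | none => 1
  | some k => sidePotential k.1 k.2.1

theorem exists_mem_potentialDomain
    (hdisj : ∀ i j : Fin n, i ≠ j → (U i).carrier ∩ (U j).carrier = ∅) (x : X) :
    ∃ k, x ∈ potentialDomain U k := by
  by_cases hx : x ∈ unionAll U
  · obtain ⟨i, hi⟩ := mem_unionAll.1 hx
    obtain ⟨e, he, hxe⟩ := (U i).exists_chart x hi
    exact ⟨some ⟨i, e, he⟩, hxe, notMem_unionExcept hdisj hi⟩
  · exact ⟨none, hx⟩

theorem eventually_potentialValue_eq {k : Option (Σ i, (U i).charts)}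
    (hk : x ∈ potentialDomain U k) (hx : x ∉ unionAll U) :
    ∀ᶠ y in 𝓝 x, potentialValue U k y = potentialValue U k x := by
  match k with
  | none => exact .of_forall fun _ => rfl
  | some k => exact eventually_sidePotential_eq k.2.2 hk.1 fun h => hx (mem_unionAll.2 ⟨_, h⟩)

/-- The local potential of a disjoint family of transversely oriented hypersurfaces. Its holonomy
along a curve in general position is the word of the curve. -/
noncomputable def crossingPotential (U : Fin n → OrientedHypersurface X d)
    (hdisj : ∀ i j : Fin n, i ≠ j → (U i).carrier ∩ (U j).carrier = ∅) :
    LocalPotential X (FreeGroup (Fin n)) (Option (Σ i, (U i).charts)) where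
  dom := potentialDomain U
  isOpen_dom
    | none => (isClosed_unionAll U).isOpen_compl
    | some k => k.2.1.open_source.inter (isClosed_unionExcept U k.1).isOpen_compl
  index x := (exists_mem_potentialDomain hdisj x).choose
  mem_dom_index x := (exists_mem_potentialDomain hdisj x).choose_spec
  val := potentialValue U
  eventually_ratio_eq k l x hk hl := by
    by_cases hx : x ∈ unionAll U
    · obtain ⟨i, hi⟩ := mem_unionAll.1 hx
      -- near a point of the `i`-th hypersurface, only its own flat charts are in the family
      have index_eq {k : Option (Σ i, (U i).charts)} (hk : x ∈ potentialDomain U k) :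
          ∃ e : (U i).charts, k = some ⟨i, e⟩ := by
        match k with
        | none => exact (hk hx).elim
        | some ⟨j, e⟩ =>
          obtain rfl : i = j := by
            by_contra hij
            exact hk.2 (mem_unionExcept.2 ⟨i, hij, hi⟩)
          exact ⟨e, rfl⟩
      obtain ⟨e, rfl⟩ := index_eq hk
      obtain ⟨e', rfl⟩ := index_eq hl
      have hside := (U i).side_compatible e e.2 e' e'.2 x hi hk.1 hl.1
      have ratio {y : X} (hy : 0 < (e.1 y).2 ↔ 0 < (e'.1 y).2) :
          potentialValue U (some ⟨i, e⟩) y * (potentialValue U (some ⟨i, e'⟩) y)⁻¹ = 1 := by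
        simp only [potentialValue, sidePotential, hy, mul_inv_cancel]
      filter_upwards [hside] with y hy
      rw [ratio hy, ratio hside.self_of_nhds]
    · filter_upwards [eventually_potentialValue_eq hk hx, eventually_potentialValue_eq hl hx]
        with y hy hy'
      rw [hy, hy']

variable {hdisj : ∀ i j : Fin n, i ≠ j → (U i).carrier ∩ (U j).carrier = ∅}

theorem crossingHolonomy_of_forall_notMem {γ : Path x y} (h : ∀ t, γ t ∉ unionAll U) :
    (crossingPotential U hdisj).holonomy ⟦γ⟧ₕ = 1 := by
  rw [(crossingPotential U hdisj).holonomy_mk (i := none) γ h]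
  exact inv_mul_cancel _

theorem crossingHolonomy_of_forall_mem_source {i : Fin n}
    {e : OpenPartialHomeomorph X (HalfSpaceModel d × ℝ)} (he : e ∈ (U i).charts) {γ : Path x y}
    (hsource : ∀ t, γ t ∈ e.source) (hexc : ∀ t, γ t ∉ unionExcept U i) :
    (crossingPotential U hdisj).holonomy ⟦γ⟧ₕ =
      (sidePotential i e x)⁻¹ * sidePotential i e y :=
  (crossingPotential U hdisj).holonomy_mk (i := some ⟨i, e, he⟩) γ fun t => ⟨hsource t, hexc t⟩

/-- The holonomy along a piece of a curve with exactly one crossing is read off at points just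
before and just after the crossing. -/
theorem exists_crossingHolonomy_subpath_eq {γ : Path x y} {s t r : I} (hst : s < t) (htr : t < r)
    {i : Fin n} {e : OpenPartialHomeomorph X (HalfSpaceModel d × ℝ)} (he : e ∈ (U i).charts)
    (hte : γ t ∈ e.source) (ht : γ t ∈ (U i).carrier)
    (honly : ∀ u, s ≤ u → u ≤ r → u ≠ t → γ u ∉ unionAll U) {L R : I → Prop}
    (hL : ∀ᶠ u in 𝓝[<] t, L u) (hR : ∀ᶠ u in 𝓝[>] t, R u) :
    ∃ a b, L a ∧ R b ∧ (crossingPotential U hdisj).holonomy ⟦γ.subpath s r⟧ₕ =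
      (sidePotential i e (γ a))⁻¹ * sidePotential i e (γ b) := by
  have hnhds : γ ⁻¹' (e.source ∩ (unionExcept U i)ᶜ) ∈ 𝓝 t :=
    ((e.open_source.inter (isClosed_unionExcept U i).isOpen_compl).preimage
      γ.continuous).mem_nhds ⟨hte, notMem_unionExcept hdisj ht⟩
  obtain ⟨l, u, ⟨hl, hu⟩, hsub⟩ := (mem_nhds_iff_exists_Ioo_subset' ⟨s, hst⟩ ⟨r, htr⟩).1 hnhds
  have : (𝓝[<] t).NeBot := nhdsLT_neBot_of_exists_lt ⟨s, hst⟩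
  have : (𝓝[>] t).NeBot := nhdsGT_neBot_of_exists_gt ⟨r, htr⟩
  obtain ⟨a, ha, ⟨hla, hat⟩⟩ := (hL.and (Ioo_mem_nhdsLT (max_lt hl hst))).exists
  obtain ⟨b, hb, ⟨htb, hbu⟩⟩ := (hR.and (Ioo_mem_nhdsGT (lt_min hu htr))).exists
  rw [max_lt_iff] at hla
  rw [lt_min_iff] at hbu
  have hmid (w : I) : γ.subpath a b w ∈ e.source ∩ (unionExcept U i)ᶜ :=
    γ.subpath_mem_of_forall_Icc (hat.trans htb).le
      (fun w hw hw' => hsub ⟨hla.1.trans_le hw, hw'.trans_lt hbu.1⟩) w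
  refine ⟨a, b, ha, hb, ?_⟩
  rw [← γ.mk_subpath_trans s a r, ← γ.mk_subpath_trans a b r, LocalPotential.holonomy_trans,
    LocalPotential.holonomy_trans,
    crossingHolonomy_of_forall_mem_source he (fun w => (hmid w).1) (fun w => (hmid w).2),
    crossingHolonomy_of_forall_notMem (γ := γ.subpath s a), crossingHolonomy_of_forall_notMem,
    one_mul, mul_one]
  · exact γ.subpath_mem_of_forall_Icc (S := (unionAll U)ᶜ) hbu.2.le
      fun w hw hw' => honly w ((hst.trans htb).le.trans hw) hw' (htb.trans_le hw).ne'
  · exact γ.subpath_mem_of_forall_Icc (S := (unionAll U)ᶜ) hla.2.le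
      fun w hw hw' => honly w hw (hw'.trans (hat.trans htr).le) (hw'.trans_lt hat).ne

theorem crossingHolonomy_subpath_of_isLetterAt {γ : Path x y} {s t r : I} (hst : s < t)
    (htr : t < r) (honly : ∀ u, s ≤ u → u ≤ r → u ≠ t → γ u ∉ unionAll U) {l : Fin n × Bool}
    (hl : IsLetterAt U γ t l) :
    (crossingPotential U hdisj).holonomy ⟦γ.subpath s r⟧ₕ = FreeGroup.mk [l] := by
  obtain ⟨i, b⟩ := l
  rcases hl with ⟨hb, e, he, hte, ht, hL, hR⟩ | ⟨hb, e, he, hte, ht, hL, hR⟩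
  · obtain ⟨a, b, ha, hb', h⟩ :=
      exists_crossingHolonomy_subpath_eq (hdisj := hdisj) hst htr he hte ht honly hL hR
    rw [h, sidePotential_of_neg ha, sidePotential_of_pos hb', inv_one, one_mul]
    obtain rfl := hb
    rfl
  · obtain ⟨a, b, ha, hb', h⟩ :=
      exists_crossingHolonomy_subpath_eq (hdisj := hdisj) hst htr he hte ht honly hL hR
    rw [h, sidePotential_of_pos ha, sidePotential_of_neg hb', mul_one]
    obtain rfl := hb
    rfl

/-! ### Loops that meet only one hypersurface -/

theorem carrier_nonempty (hsimply : SimplyConnectedSpace ↥((unionAll U)ᶜ))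
    (hint : ∀ (j : Fin n) (x : ↥((unionExcept U j)ᶜ)),
      Nonempty (FundamentalGroup ↥((unionExcept U j)ᶜ) x ≃* Multiplicative ℤ)) (i : Fin n) :
    (U i).carrier.Nonempty := by
  by_contra! hempty
  have hset : unionExcept U i = unionAll U := by
    ext x
    refine not_iff_not.1 ⟨fun h => notMem_unionAll_iff.2 ⟨h, by simp [hempty]⟩, fun h =>
      (notMem_unionAll_iff.1 h).1⟩
  have h := hint i
  rw [hset] at h
  obtain ⟨x⟩ : Nonempty ↥((unionAll U)ᶜ) := inferInstance
  obtain ⟨E⟩ := h x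
  exact not_subsingleton (Multiplicative ℤ) (E.symm.injective.subsingleton)

/-- At each base point off the hypersurfaces there is a loop that is dual to the `i`-th one: it
avoids the others and has holonomy `u_i`. -/
theorem exists_dual_loop (hdisj : ∀ i j : Fin n, i ≠ j → (U i).carrier ∩ (U j).carrier = ∅)
    (hsimply : SimplyConnectedSpace ↥((unionAll U)ᶜ)) {i : Fin n}
    (hne : (U i).carrier.Nonempty) (hx : x ∉ unionAll U) :
    ∃ γ : Path x x, (∀ t, γ t ∉ unionExcept U i) ∧
      (crossingPotential U hdisj).holonomy ⟦γ⟧ₕ = FreeGroup.of i := by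
  obtain ⟨p, hp⟩ := hne
  obtain ⟨e, he, B, hB, hpB, hbox⟩ := exists_isFlatBox_avoiding hdisj hp
  obtain ⟨q, hqB, hq⟩ := hbox.exists_neg
  obtain ⟨r, hrB, hr⟩ := hbox.exists_pos
  obtain ⟨τ, hτ, -⟩ := hbox.exists_segment hqB hrB
  obtain ⟨α, hα⟩ := Path.exists_of_pathConnectedSpace (S := (unionAll U)ᶜ) hx
    (notMem_unionAll_of_ne_zero he (hbox.subset_source hqB) (hB hqB) hq.ne)
  obtain ⟨β, hβ⟩ := Path.exists_of_pathConnectedSpace (S := (unionAll U)ᶜ)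
    (notMem_unionAll_of_ne_zero he (hbox.subset_source hrB) (hB hrB) hr.ne') hx
  refine ⟨α.trans (τ.trans β), Path.trans_mem (S := (unionExcept U i)ᶜ)
    (fun t => (notMem_unionAll_iff.1 (hα t)).1)
    (Path.trans_mem (fun t => hB (hτ t)) fun t => (notMem_unionAll_iff.1 (hβ t)).1), ?_⟩
  rw [Path.Homotopic.Quotient.mk_trans, Path.Homotopic.Quotient.mk_trans,
    LocalPotential.holonomy_trans, LocalPotential.holonomy_trans,
    crossingHolonomy_of_forall_notMem hα, crossingHolonomy_of_forall_notMem hβ,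
    crossingHolonomy_of_forall_mem_source he (fun t => hbox.subset_source (hτ t))
      (fun t => hB (hτ t)), sidePotential_of_neg hq, sidePotential_of_pos hr]
  simp

/-- A surjective homomorphism from an infinite cyclic group to `ℤ` is injective. -/
theorem injective_of_surjective_of_mulEquiv_int {G : Type*} [Group G]
    (E : G ≃* Multiplicative ℤ) (f : G →* Multiplicative ℤ) (hf : Function.Surjective f) :
    Function.Injective f := by
  let g : ℤ →+ ℤ := MonoidHom.toAdditive (f.comp E.symm.toMonoidHom)
  have hg_apply (k : ℤ) : g k = k * g 1 := by
    simpa using map_zsmul g k 1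
  have hg : Function.Surjective g := hf.comp E.symm.surjective
  have hg1 : g 1 ≠ 0 := by
    intro h
    obtain ⟨k, hk⟩ := hg 1
    rw [hg_apply, h, mul_zero] at hk
    exact zero_ne_one hk
  have hg_inj : Function.Injective g := fun k l hkl => by
    rw [hg_apply k, hg_apply l] at hkl
    exact mul_right_cancel₀ hg1 hkl
  have : Function.Injective (f ∘ E.symm) := hg_inj
  exact (Function.Injective.of_comp_iff' f E.symm.bijective).1 this

/-- Loops that avoid all hypersurfaces but the `j`-th one are determined up to homotopy by their
holonomy: the exponent sum of `u_j` is a surjection of the fundamental group of the complement of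
the others, which is infinite cyclic, onto `ℤ`, hence it is injective. -/
theorem homotopic_of_crossingHolonomy_eq (hsimply : SimplyConnectedSpace ↥((unionAll U)ᶜ))
    (hint : ∀ (j : Fin n) (x : ↥((unionExcept U j)ᶜ)),
      Nonempty (FundamentalGroup ↥((unionExcept U j)ᶜ) x ≃* Multiplicative ℤ)) {j : Fin n}
    (hx : x ∉ unionAll U) {α β : Path x x} (hα : ∀ t, α t ∉ unionExcept U j)
    (hβ : ∀ t, β t ∉ unionExcept U j)
    (h : (crossingPotential U hdisj).holonomy ⟦α⟧ₕ = (crossingPotential U hdisj).holonomy ⟦β⟧ₕ) :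
    α.Homotopic β := by
  let S : Set X := (unionExcept U j)ᶜ
  let incl : C(S, X) := ⟨Subtype.val, continuous_subtype_val⟩
  let x' : S := ⟨x, (notMem_unionAll_iff.1 hx).1⟩
  let exponent : FreeGroup (Fin n) →* Multiplicative ℤ :=
    FreeGroup.lift fun i => if i = j then Multiplicative.ofAdd 1 else 1
  let θ : FundamentalGroup S x' →* Multiplicative ℤ := MonoidHom.mk'
    (fun p => exponent ((crossingPotential U hdisj).holonomy
      (Path.Homotopic.Quotient.map p.toPath incl))) fun p q => by
        have hmap : Path.Homotopic.Quotient.map (p * q).toPath incl =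
            (Path.Homotopic.Quotient.map q.toPath incl).trans
              (Path.Homotopic.Quotient.map p.toPath incl) :=
          (FundamentalGroupoid.map incl).map_comp q p
        rw [hmap, LocalPotential.holonomy_trans, map_mul, mul_comm]
  have hθ {γ : Path x x} (hγ : ∀ t, γ t ∈ S) :
      θ (FundamentalGroup.fromPath ⟦γ.codRestrict S hγ⟧ₕ) =
        exponent ((crossingPotential U hdisj).holonomy ⟦γ⟧ₕ) := rfl
  have hsurj : Function.Surjective θ := by
    obtain ⟨γ, hγ, hγ'⟩ := exists_dual_loop hdisj hsimply (carrier_nonempty hsimply hint j) hx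
    have hgen : θ (FundamentalGroup.fromPath ⟦γ.codRestrict S hγ⟧ₕ) = Multiplicative.ofAdd 1 := by
      rw [hθ, hγ']
      simp [exponent]
    intro k
    refine ⟨FundamentalGroup.fromPath ⟦γ.codRestrict S hγ⟧ₕ ^ k.toAdd, ?_⟩
    rw [map_zpow, hgen, ← ofAdd_zsmul]
    simp
  obtain ⟨E⟩ := hint j x'
  have hinj := injective_of_surjective_of_mulEquiv_int E θ hsurj
  have heq := hinj (((hθ hα).trans (congrArg exponent h)).trans (hθ hβ).symm)
  exact .of_codRestrict hα hβ (Path.Homotopic.Quotient.eq.1 heq)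

end Holonomy

/-! ### The class of a curve in terms of its word -/

section WordClass

variable {X : Type*} [TopologicalSpace X] {d n : ℕ} {U : Fin n → OrientedHypersurface X d}
  {x₀ x y : X}

/-- The homomorphism from the free group to the opposite of the fundamental group that sends each
letter to a given loop. The product of the opposite group is concatenation in the order of
traversal. -/
noncomputable def loopHom (ℓ : Fin n → Path x₀ x₀) :
    FreeGroup (Fin n) →* (FundamentalGroup X x₀)ᵐᵒᵖ :=
  FreeGroup.lift fun i => MulOpposite.op (FundamentalGroup.fromPath ⟦ℓ i⟧ₕ)

/-- The homotopy class of the loop that spells a given element of the free group. -/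
noncomputable def loopClass (ℓ : Fin n → Path x₀ x₀) (g : FreeGroup (Fin n)) :
    Path.Homotopic.Quotient x₀ x₀ :=
  (loopHom ℓ g).unop.toPath

theorem loopClass_one (ℓ : Fin n → Path x₀ x₀) : loopClass ℓ 1 = .refl x₀ := by
  rw [loopClass, map_one]
  rfl

theorem loopClass_mul (ℓ : Fin n → Path x₀ x₀) (g h : FreeGroup (Fin n)) :
    loopClass ℓ (g * h) = (loopClass ℓ g).trans (loopClass ℓ h) := by
  rw [loopClass, map_mul]
  rfl

theorem loopClass_mk_true (ℓ : Fin n → Path x₀ x₀) (i : Fin n) :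
    loopClass ℓ (FreeGroup.mk [(i, true)]) = ⟦ℓ i⟧ₕ := by
  rw [loopClass, loopHom, show FreeGroup.mk [(i, true)] = FreeGroup.of i from rfl,
    FreeGroup.lift_apply_of]
  rfl

theorem loopClass_mk_false (ℓ : Fin n → Path x₀ x₀) (i : Fin n) :
    loopClass ℓ (FreeGroup.mk [(i, false)]) = ⟦(ℓ i).symm⟧ₕ := by
  rw [loopClass, loopHom, show FreeGroup.mk [(i, false)] = (FreeGroup.of i)⁻¹ from rfl, map_inv,
    FreeGroup.lift_apply_of]
  rfl

/-- Holonomy as a homomorphism on the opposite of the fundamental group. -/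
noncomputable def LocalPotential.holonomyHom {G ι : Type*} [Group G] (P : LocalPotential X G ι)
    (x₀ : X) : (FundamentalGroup X x₀)ᵐᵒᵖ →* G :=
  MonoidHom.mk' (fun p => P.holonomy p.unop.toPath) fun _ _ => P.holonomy_trans _ _

variable {hdisj : ∀ i j : Fin n, i ≠ j → (U i).carrier ∩ (U j).carrier = ∅}

theorem crossingHolonomy_loopClass {ℓ : Fin n → Path x₀ x₀}
    (hℓ : ∀ i, (crossingPotential U hdisj).holonomy ⟦ℓ i⟧ₕ = FreeGroup.of i)
    (g : FreeGroup (Fin n)) : (crossingPotential U hdisj).holonomy (loopClass ℓ g) = g := by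
  have : ((crossingPotential U hdisj).holonomyHom x₀).comp (loopHom ℓ) =
      MonoidHom.id (FreeGroup (Fin n)) := by
    ext i
    rw [MonoidHom.comp_apply, loopHom, FreeGroup.lift_apply_of]
    exact hℓ i
  exact DFunLike.congr_fun this g

/-- A piece of a curve with exactly one crossing, closed up off the hypersurfaces, is homotopic to
the dual loop of its letter or to the inverse of that loop. -/
theorem mk_trans_subpath_of_isLetterAt (hsimply : SimplyConnectedSpace ↥((unionAll U)ᶜ))
    (hint : ∀ (j : Fin n) (x : ↥((unionExcept U j)ᶜ)),
      Nonempty (FundamentalGroup ↥((unionExcept U j)ᶜ) x ≃* Multiplicative ℤ))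
    (hx₀ : x₀ ∉ unionAll U) {ℓ : Fin n → Path x₀ x₀} (hℓ_mem : ∀ i t, ℓ i t ∉ unionExcept U i)
    (hℓ : ∀ i, (crossingPotential U hdisj).holonomy ⟦ℓ i⟧ₕ = FreeGroup.of i)
    {γ : Path x y} {s t r : I} (hst : s < t) (htr : t < r)
    (honly : ∀ u, s ≤ u → u ≤ r → u ≠ t → γ u ∉ unionAll U) {l : Fin n × Bool}
    (hl : IsLetterAt U γ t l) {α : Path x₀ (γ s)} {β : Path x₀ (γ r)}
    (hα : ∀ u, α u ∉ unionAll U) (hβ : ∀ u, β u ∉ unionAll U) :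
    (⟦α⟧ₕ).trans ((⟦γ.subpath s r⟧ₕ).trans (⟦β⟧ₕ).symm) = loopClass ℓ (FreeGroup.mk [l]) := by
  have hβ' : ∀ u, β.symm u ∉ unionAll U := Path.symm_mem (S := (unionAll U)ᶜ) hβ
  have hmem : ∀ u, α.trans ((γ.subpath s r).trans β.symm) u ∉ unionExcept U l.1 := by
    refine Path.trans_mem (S := (unionExcept U l.1)ᶜ) (fun u => (notMem_unionAll_iff.1 (hα u)).1)
      (Path.trans_mem (γ.subpath_mem_of_forall_Icc (hst.trans htr).le fun u hu hu' => ?_)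
        fun u => (notMem_unionAll_iff.1 (hβ' u)).1)
    by_cases hut : u = t
    · exact hut ▸ notMem_unionExcept hdisj hl.mem_carrier
    · exact (notMem_unionAll_iff.1 (honly u hu hu' hut)).1
  have hhol : (crossingPotential U hdisj).holonomy ⟦α.trans ((γ.subpath s r).trans β.symm)⟧ₕ =
      FreeGroup.mk [l] := by
    rw [Path.Homotopic.Quotient.mk_trans, Path.Homotopic.Quotient.mk_trans,
      LocalPotential.holonomy_trans, LocalPotential.holonomy_trans,
      crossingHolonomy_of_forall_notMem hα, crossingHolonomy_of_forall_notMem hβ',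
      crossingHolonomy_subpath_of_isLetterAt hst htr honly hl, one_mul, mul_one]
  have hclass : ∃ δ : Path x₀ x₀, loopClass ℓ (FreeGroup.mk [l]) = ⟦δ⟧ₕ ∧
      ∀ u, δ u ∉ unionExcept U l.1 := by
    obtain ⟨i, _ | _⟩ := l
    · exact ⟨_, loopClass_mk_false ℓ i, Path.symm_mem (S := (unionExcept U i)ᶜ) (hℓ_mem i)⟩
    · exact ⟨_, loopClass_mk_true ℓ i, hℓ_mem i⟩
  obtain ⟨δ, hδ, hδ_mem⟩ := hclass
  rw [hδ]
  refine Path.Homotopic.Quotient.eq.2 (homotopic_of_crossingHolonomy_eq (hdisj := hdisj) hsimply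
    hint hx₀ hmem hδ_mem ?_)
  rw [hhol, ← hδ, crossingHolonomy_loopClass hℓ]

/-- The rest of a curve in general position after the time `s`, closed up off the hypersurfaces, is
homotopic to the loop that spells the word of the crossings after `s`. The proof is by induction on
the number of these crossings, returning to the base point between any two of them. -/
theorem mk_trans_subpath_eq_loopClass (hsimply : SimplyConnectedSpace ↥((unionAll U)ᶜ))
    (hint : ∀ (j : Fin n) (x : ↥((unionExcept U j)ᶜ)),
      Nonempty (FundamentalGroup ↥((unionExcept U j)ᶜ) x ≃* Multiplicative ℤ))
    (hx₀ : x₀ ∉ unionAll U) {ℓ : Fin n → Path x₀ x₀} (hℓ_mem : ∀ i t, ℓ i t ∉ unionExcept U i)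
    (hℓ : ∀ i, (crossingPotential U hdisj).holonomy ⟦ℓ i⟧ₕ = FreeGroup.of i)
    {γ : Path x y} (hy : y ∉ unionAll U) {ts : List I} {w : List (Fin n × Bool)}
    (hw : List.Forall₂ (IsLetterAt U γ) ts w) (hts : ts.Pairwise (· < ·)) {s : I}
    (hs : ∀ t ∈ ts, s < t) (hmem : ∀ t, s ≤ t → (t ∈ ts ↔ γ t ∈ unionAll U))
    {α : Path x₀ (γ s)} {β : Path x₀ (γ 1)} (hα : ∀ u, α u ∉ unionAll U)
    (hβ : ∀ u, β u ∉ unionAll U) :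
    (⟦α⟧ₕ).trans ((⟦γ.subpath s 1⟧ₕ).trans (⟦β⟧ₕ).symm) = loopClass ℓ (FreeGroup.mk w) := by
  induction hw generalizing s with
  | nil =>
    rw [← FreeGroup.one_eq_mk, loopClass_one]
    refine Path.Homotopic.Quotient.eq.2 (Path.homotopic_of_simplyConnectedSpace
      (γ := α.trans ((γ.subpath s 1).trans β.symm)) (γ' := Path.refl x₀) (S := (unionAll U)ᶜ)
      (Path.trans_mem hα (Path.trans_mem ?_ (Path.symm_mem hβ))) fun _ => hx₀)
    exact γ.subpath_mem_of_forall_Icc le_one' fun u hu _ hU => by simpa using (hmem u hu).2 hU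
  | @cons t l ts w hl _ ih =>
    rw [List.pairwise_cons] at hts
    have hst := hs t List.mem_cons_self
    have ht_mem : γ t ∈ unionAll U := (hmem t hst.le).1 List.mem_cons_self
    -- a time between this crossing and the next one
    obtain ⟨r, htr, hr⟩ : ∃ r, t < r ∧ ∀ t' ∈ ts, r < t' := by
      match ts with
      | [] =>
        refine ⟨1, lt_of_le_of_ne le_one' ?_, by simp⟩
        rintro rfl
        exact hy (by simpa using ht_mem)
      | t₁ :: ts =>
        obtain ⟨r, htr, hr⟩ := exists_between (hts.1 t₁ List.mem_cons_self)
        refine ⟨r, htr, fun t' ht' => ?_⟩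
        rcases List.mem_cons.1 ht' with rfl | ht'
        · exact hr
        · exact hr.trans ((List.pairwise_cons.1 hts.2).1 t' ht')
    have honly (u : I) (hu : s ≤ u) (hur : u ≤ r) (hut : u ≠ t) : γ u ∉ unionAll U := by
      intro hU
      rcases List.mem_cons.1 ((hmem u hu).2 hU) with h | h
      · exact hut h
      · exact (hr u h).not_ge hur
    obtain ⟨κ, hκ⟩ := Path.exists_of_pathConnectedSpace (S := (unionAll U)ᶜ) hx₀
      (honly r (hst.trans htr).le le_rfl htr.ne')
    have hrest := ih hts.2 hr (fun u hu => by
      rw [← hmem u ((hst.trans htr).le.trans hu), List.mem_cons,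
        or_iff_right (htr.trans_le hu).ne']) hκ
    have hpiece := mk_trans_subpath_of_isLetterAt hsimply hint hx₀ hℓ_mem hℓ hst htr honly hl hα hκ
    rw [show FreeGroup.mk (l :: w) = FreeGroup.mk [l] * FreeGroup.mk w from rfl, loopClass_mul,
      ← hrest, ← hpiece, ← γ.mk_subpath_trans s r 1]
    simp only [Path.Homotopic.Quotient.trans_assoc]
    rw [← Path.Homotopic.Quotient.trans_assoc (⟦κ⟧ₕ).symm, Path.Homotopic.Quotient.symm_trans,
      Path.Homotopic.Quotient.refl_trans]

/-- A curve in general position, closed up off the hypersurfaces, is homotopic to the loop that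
spells its word. -/
theorem IsCrossingWord.mk_trans_eq_loopClass (hsimply : SimplyConnectedSpace ↥((unionAll U)ᶜ))
    (hint : ∀ (j : Fin n) (x : ↥((unionExcept U j)ᶜ)),
      Nonempty (FundamentalGroup ↥((unionExcept U j)ᶜ) x ≃* Multiplicative ℤ))
    (hx₀ : x₀ ∉ unionAll U) {ℓ : Fin n → Path x₀ x₀} (hℓ_mem : ∀ i t, ℓ i t ∉ unionExcept U i)
    (hℓ : ∀ i, (crossingPotential U hdisj).holonomy ⟦ℓ i⟧ₕ = FreeGroup.of i)
    {γ : Path x y} {w : List (Fin n × Bool)} (hw : IsCrossingWord U γ w) {α : Path x₀ x}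
    {β : Path x₀ y} (hα : ∀ u, α u ∉ unionAll U) (hβ : ∀ u, β u ∉ unionAll U) :
    (⟦α⟧ₕ).trans ((⟦γ⟧ₕ).trans (⟦β⟧ₕ).symm) = loopClass ℓ (FreeGroup.mk w) := by
  obtain ⟨hgp, ts, hts, hmem, hw⟩ := hw
  have h := mk_trans_subpath_eq_loopClass hsimply hint hx₀ hℓ_mem hℓ hgp.2.1 hw hts (s := 0)
    (fun t ht => ?_) (fun t _ => hmem t) (α := α.cast rfl γ.source) (β := β.cast rfl γ.target)
    hα hβ
  · rw [Path.subpath_zero_one] at h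
    have key (x' y' : X) (hx : x' = x) (hy : y' = y) (c : Path.Homotopic.Quotient x₀ x₀)
        (h : (⟦α.cast rfl hx⟧ₕ).trans ((⟦γ.cast hx hy⟧ₕ).trans (⟦β.cast rfl hy⟧ₕ).symm) = c) :
        (⟦α⟧ₕ).trans ((⟦γ⟧ₕ).trans (⟦β⟧ₕ).symm) = c := by
      subst hx hy
      exact h
    exact key _ _ _ _ _ h
  · refine unitInterval.pos_iff_ne_zero.2 ?_
    rintro rfl
    exact hgp.1 (by simpa using (hmem 0).1 ht)

theorem IsCrossingWord.crossingHolonomy_eq (hsimply : SimplyConnectedSpace ↥((unionAll U)ᶜ))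
    (hint : ∀ (j : Fin n) (x : ↥((unionExcept U j)ᶜ)),
      Nonempty (FundamentalGroup ↥((unionExcept U j)ᶜ) x ≃* Multiplicative ℤ))
    {γ : Path x y} {w : List (Fin n × Bool)} (hw : IsCrossingWord U γ w) :
    (crossingPotential U hdisj).holonomy ⟦γ⟧ₕ = FreeGroup.mk w := by
  have hx := hw.1.1
  choose ℓ hℓ_mem hℓ using fun i =>
    exists_dual_loop hdisj hsimply (carrier_nonempty hsimply hint i) hx
  obtain ⟨β, hβ⟩ := Path.exists_of_pathConnectedSpace (S := (unionAll U)ᶜ) hx hw.1.2.1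
  have h := hw.mk_trans_eq_loopClass hsimply hint hx hℓ_mem hℓ (α := Path.refl x) (fun _ => hx) hβ
  have h' := congrArg (crossingPotential U hdisj).holonomy h
  rwa [crossingHolonomy_loopClass hℓ, LocalPotential.holonomy_trans, LocalPotential.holonomy_trans,
    LocalPotential.holonomy_symm, crossingHolonomy_of_forall_notMem hβ,
    crossingHolonomy_of_forall_notMem (γ := Path.refl x) (fun _ => hx), one_mul, inv_one,
    mul_one] at h'

end WordClass

/-! ### The fundamental group -/

section MainResult

variable {X : Type*} [TopologicalSpace X] {d n : ℕ} {U : Fin n → OrientedHypersurface X d}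
  {x₀ x y : X}

/-- Curves in general position are homotopic if and only if their words agree in the free group. -/
theorem homotopic_iff_mk_eq_mk
    (hdisj : ∀ i j : Fin n, i ≠ j → (U i).carrier ∩ (U j).carrier = ∅)
    (hsimply : SimplyConnectedSpace ↥((unionAll U)ᶜ))
    (hint : ∀ (j : Fin n) (x : ↥((unionExcept U j)ᶜ)),
      Nonempty (FundamentalGroup ↥((unionExcept U j)ᶜ) x ≃* Multiplicative ℤ))
    {γ₁ γ₂ : Path x y} {w₁ w₂ : List (Fin n × Bool)} (h₁ : IsCrossingWord U γ₁ w₁)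
    (h₂ : IsCrossingWord U γ₂ w₂) :
    γ₁.Homotopic γ₂ ↔ FreeGroup.mk w₁ = FreeGroup.mk w₂ := by
  refine ⟨fun h => ?_, fun h => ?_⟩
  · rw [← h₁.crossingHolonomy_eq (hdisj := hdisj) hsimply hint,
      ← h₂.crossingHolonomy_eq (hdisj := hdisj) hsimply hint, Path.Homotopic.Quotient.eq.2 h]
  · have hx := h₁.1.1
    choose ℓ hℓ_mem hℓ using fun i =>
      exists_dual_loop hdisj hsimply (carrier_nonempty hsimply hint i) hx
    obtain ⟨β, hβ⟩ := Path.exists_of_pathConnectedSpace (S := (unionAll U)ᶜ) hx h₁.1.2.1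
    have e₁ := h₁.mk_trans_eq_loopClass hsimply hint hx hℓ_mem hℓ (α := Path.refl x)
      (fun _ => hx) hβ
    have e₂ := h₂.mk_trans_eq_loopClass hsimply hint hx hℓ_mem hℓ (α := Path.refl x)
      (fun _ => hx) hβ
    rw [h, ← e₂, Path.Homotopic.Quotient.mk_refl, Path.Homotopic.Quotient.refl_trans,
      Path.Homotopic.Quotient.refl_trans] at e₁
    have e := congrArg (fun c => Path.Homotopic.Quotient.trans c ⟦β⟧ₕ) e₁
    simp only [Path.Homotopic.Quotient.trans_assoc, Path.Homotopic.Quotient.symm_trans,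
      Path.Homotopic.Quotient.trans_refl] at e
    exact Path.Homotopic.Quotient.eq.1 e

theorem pathConnectedSpace_of_simplyConnectedSpace_compl
    (hdisj : ∀ i j : Fin n, i ≠ j → (U i).carrier ∩ (U j).carrier = ∅)
    (hsimply : SimplyConnectedSpace ↥((unionAll U)ᶜ)) : PathConnectedSpace X := by
  have hpush (p : X) : ∃ q ∈ (unionAll U)ᶜ, Joined p q := by
    obtain ⟨q, δ, hδ⟩ := exists_push_off hdisj p
    exact ⟨q, by simpa using hδ 1 one_pos, ⟨δ⟩⟩
  obtain ⟨z⟩ : Nonempty ↥((unionAll U)ᶜ) := inferInstance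
  refine ⟨⟨z⟩, fun x y => ?_⟩
  obtain ⟨x', hx', hxx'⟩ := hpush x
  obtain ⟨y', hy', hyy'⟩ := hpush y
  obtain ⟨γ, -⟩ := Path.exists_of_pathConnectedSpace hx' hy'
  exact (hxx'.trans ⟨γ⟩).trans hyy'.symm

/-- Holonomy is an isomorphism of the fundamental group onto the free group. -/
theorem exists_mulEquiv_freeGroup
    (hdisj : ∀ i j : Fin n, i ≠ j → (U i).carrier ∩ (U j).carrier = ∅)
    (hsimply : SimplyConnectedSpace ↥((unionAll U)ᶜ))
    (hint : ∀ (j : Fin n) (x : ↥((unionExcept U j)ᶜ)),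
      Nonempty (FundamentalGroup ↥((unionExcept U j)ᶜ) x ≃* Multiplicative ℤ))
    (hx₀ : x₀ ∉ unionAll U) :
    ∃ φ : (FundamentalGroup X x₀)ᵐᵒᵖ ≃* FreeGroup (Fin n),
      ∀ (γ : Path x₀ x₀) (w : List (Fin n × Bool)), IsCrossingWord U γ w →
        φ (MulOpposite.op (FundamentalGroup.fromPath ⟦γ⟧ₕ)) = FreeGroup.mk w := by
  have hhol {γ : Path x₀ x₀} {w : List (Fin n × Bool)} (hw : IsCrossingWord U γ w) :
      (crossingPotential U hdisj).holonomyHom x₀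
        (MulOpposite.op (FundamentalGroup.fromPath ⟦γ⟧ₕ)) = FreeGroup.mk w :=
    hw.crossingHolonomy_eq hsimply hint
  refine ⟨MulEquiv.ofBijective ((crossingPotential U hdisj).holonomyHom x₀) ⟨?_, fun g => ?_⟩,
    fun γ w hw => hhol hw⟩
  · have hrep (p : (FundamentalGroup X x₀)ᵐᵒᵖ) : ∃ (γ : Path x₀ x₀) (w : List (Fin n × Bool)),
        p = MulOpposite.op (FundamentalGroup.fromPath ⟦γ⟧ₕ) ∧ IsCrossingWord U γ w := by
      obtain ⟨γ, hγ⟩ := Path.Homotopic.Quotient.mk_surjective p.unop.toPath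
      obtain ⟨γ', h, hgp⟩ := exists_homotopic_inGeneralPosition hdisj hx₀ hx₀ γ
      obtain ⟨w, hw, -⟩ := hgp.existsUnique_isCrossingWord hdisj
      exact ⟨γ', w, congrArg MulOpposite.op
        (hγ.symm.trans (Path.Homotopic.Quotient.eq.2 h)), hw⟩
    intro p q hpq
    obtain ⟨γ, w, rfl, hw⟩ := hrep p
    obtain ⟨γ', w', rfl, hw'⟩ := hrep q
    rw [hhol hw, hhol hw'] at hpq
    have h := (homotopic_iff_mk_eq_mk hdisj hsimply hint hw hw').2 hpq
    rw [Path.Homotopic.Quotient.eq.2 h]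
  · choose ℓ hℓ_mem hℓ using fun i =>
      exists_dual_loop hdisj hsimply (carrier_nonempty hsimply hint i) hx₀
    exact ⟨loopHom ℓ g, crossingHolonomy_loopClass hℓ g⟩

end MainResult

theorem proposition1 {d n : ℕ} {X : Type*} [TopologicalSpace X] [T2Space X]
    [SecondCountableTopology X] [ChartedSpace (EuclideanHalfSpace (d + 1)) X]
    (U : Fin n → OrientedHypersurface X d)
    (hdisj : ∀ i j : Fin n, i ≠ j → (U i).carrier ∩ (U j).carrier = ∅)
    (hsimply : SimplyConnectedSpace ↥((unionAll U)ᶜ))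
    (hint : ∀ (j : Fin n) (x : ↥((unionExcept U j)ᶜ)),
      Nonempty (FundamentalGroup ↥((unionExcept U j)ᶜ) x ≃* Multiplicative ℤ)) :
    -- every curve in general position has exactly one word
    (∀ (x y : X) (γ : Path x y), InGeneralPosition U γ →
      ∃! w : List (Fin n × Bool), IsCrossingWord U γ w) ∧
    -- every homotopy class of curves (with endpoints off the `U i`) has a member in general position
    (∀ (x y : X), x ∉ unionAll U → y ∉ unionAll U → ∀ γ : Path x y,
      ∃ γ' : Path x y, γ.Homotopic γ' ∧ InGeneralPosition U γ') ∧
    -- the words, up to cancellation, are complete homotopy invariants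
    (∀ (x y : X) (γ₁ γ₂ : Path x y) (w₁ w₂ : List (Fin n × Bool)),
      IsCrossingWord U γ₁ w₁ → IsCrossingWord U γ₂ w₂ →
        (γ₁.Homotopic γ₂ ↔ FreeGroup.mk w₁ = FreeGroup.mk w₂)) ∧
    -- `X` is path connected, and its fundamental group is free on the letters `u_i`, through the
    -- map that sends the class of a loop to its word; the product of two classes `p`, `q` in
    -- `FundamentalGroup` is that of the loop `q` followed by `p`, whence the opposite group
    PathConnectedSpace X ∧
    (∀ x₀ : X, Nonempty (FundamentalGroup X x₀ ≃* FreeGroup (Fin n))) ∧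
    (∀ x₀ : X, x₀ ∉ unionAll U →
      ∃ φ : (FundamentalGroup X x₀)ᵐᵒᵖ ≃* FreeGroup (Fin n),
        ∀ (γ : Path x₀ x₀) (w : List (Fin n × Bool)), IsCrossingWord U γ w →
          φ (MulOpposite.op (FundamentalGroup.fromPath (Path.Homotopic.Quotient.mk γ))) =
            FreeGroup.mk w) := by
  have hX := pathConnectedSpace_of_simplyConnectedSpace_compl hdisj hsimply
  refine ⟨fun x y γ h => h.existsUnique_isCrossingWord hdisj,
    fun x y hx hy γ => exists_homotopic_inGeneralPosition hdisj hx hy γ,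
    fun x y γ₁ γ₂ w₁ w₂ h₁ h₂ => homotopic_iff_mk_eq_mk hdisj hsimply hint h₁ h₂, hX,
    fun x₀ => ?_, fun x₀ hx₀ => exists_mulEquiv_freeGroup hdisj hsimply hint hx₀⟩
  obtain ⟨z⟩ : Nonempty ↥((unionAll U)ᶜ) := inferInstance
  obtain ⟨φ, -⟩ := exists_mulEquiv_freeGroup hdisj hsimply hint z.2
  exact ⟨(FundamentalGroup.fundamentalGroupMulEquivOfPathConnected x₀ z.1).trans
    ((MulEquiv.inv' _).trans φ)⟩
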